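/- Let $p$ be a prime number, let $G=\mathbb Z_{p^2}\times\mathbb Z_{p^2}$, and let $A\subseteq G$ be a non-empty subset. Call $A$ spectral if there is a set $S\subseteq G$ such that the exponentials $x\mapsto e^{2\pi i(s_1x_1+s_2x_2)/p^2}$, $s=(s_1,s_2)\in S$, form an orthogonal basis of $L^2(A)$ with respect to the counting measure. Call $A$ a tile if there is a set $B\subseteq G$ such that every element of $G$ can be written in exactly one way as $a+b$ with $a\in A$ and $b\in B$. Then $A$ is spectral if and only if $A$ is a tile. -/

import Mathlib

/-- The exponential `x ↦ e^{2πi s·x/n}` restricted to `A`, as an element of `L²(A)` for the counting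
measure on `A`, where `s·x = s₁x₁ + s₂x₂`. Here `ZMod.stdAddChar j = e^{2πi j/n}`. -/
noncomputable def expOn {n : ℕ} [NeZero n] (A : Finset (ZMod n × ZMod n)) (s : ZMod n × ZMod n) :
    EuclideanSpace ℂ A :=
  WithLp.toLp 2 fun x : A => ZMod.stdAddChar (s.1 * x.1.1 + s.2 * x.1.2)

/-- `(A, S)` is a (Euclidean) spectral pair: the exponentials with frequencies in `S` form an
orthogonal basis of `L²(A)`. -/
def IsSpectralPair {n : ℕ} [NeZero n] (A S : Finset (ZMod n × ZMod n)) : Prop :=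
  (∀ s ∈ S, ∀ t ∈ S, s ≠ t → inner ℂ (expOn A s) (expOn A t) = 0) ∧
    LinearIndependent ℂ (fun s : S => expOn A s.1) ∧
    Submodule.span ℂ (Set.range fun s : S => expOn A s.1) = ⊤

/-- `A` is spectral if it has a spectrum `S`. -/
def IsSpectral {n : ℕ} [NeZero n] (A : Finset (ZMod n × ZMod n)) : Prop :=
  ∃ S : Finset (ZMod n × ZMod n), IsSpectralPair A S

/-- `A` is a tile of the finite abelian group `G`: there is `B ⊆ G` with `A ⊕ B = G`, that is,
`(a, b) ↦ a + b` is a bijection from `A × B` onto `G`. -/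
def IsTile {G : Type*} [AddCommGroup G] (A : Finset G) : Prop :=
  ∃ B : Finset G, AddSubgroup.IsComplement (A : Set G) (B : Set G)

open Finset
set_option linter.unusedSectionVars false

/-! ### Arithmetic of `ZMod (p ^ 2)`: units, multiples of `p`, digits -/

section Ring

/-! Rotating the frequencies replaces the dot product by the symplectic form. A Fourier coefficient
of `A` is then a sum of p²-th roots of unity, and irreducibility of the cyclotomic polynomial turns
its vanishing into the counting condition `Van A s` (`sympFourier_eq_zero_iff`). For primitive `s`
(that is, `p • s ≠ 0`) it says that every line mod p in direction `s` is shared evenly among its `p`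
cosets of ⟨s⟩ (`Van.p_mul_cos`). At `p • s` it says that `A` is shared evenly among the `p` parallel
lines mod p (`Van.p_mul_lin`). Vanishing is unchanged by unit multiples, and double counting over
the `p + 1` directions mod p turns families of zeros into structure: equal fibres mod p, or unions
of cosets (`card_eq_p_sq_mul_fib`, `fib_eq_p_mul_hco`, `hco_eq_of_van_off`).

A spectrum amounts to a set `S` with `#S = #A` whose nonzero differences are zeros of `A`, and this
relation is symmetric (`Orth.symm`). Hence each frequency that is not a zero of one set forbids
differences in the other. If `#A > 1` then `p ∣ #A`. Sizes strictly between `p` and `p²`, or between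
`p²` and `p³`, are contradictory; above `p³` only the whole group remains; for the sizes `1`, `p`,
`p²`, `p³` a complement is written down, usually combinations of two vectors with digits, multiples
of `p` or arbitrary coefficients.

Conversely, if `A ⊕ B = G` then `#A` is a power of `p` and every nonzero frequency is a zero of `A`
or of `B`. The few zeros that `B` can have leave enough zeros of `A` for an explicit spectrum. At
size `p²` both implications end in the same critical configuration, isolated in `exists_direction`.
-/

theorem ZMod.sq_cast_mul_cast {p : ℕ} : (p : ZMod (p ^ 2)) * p = 0 := by
  rw [← Nat.cast_mul, ← pow_two, ZMod.natCast_self]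

theorem ZMod.p_mul_p_mul {p : ℕ} (c : ZMod (p ^ 2)) :
    (p : ZMod (p ^ 2)) * ((p : ZMod (p ^ 2)) * c) = 0 := by
  rw [← mul_assoc, ZMod.sq_cast_mul_cast, zero_mul]

variable {p : ℕ} [hp : Fact p.Prime]

theorem ZMod.sq_cast_eq_zero_or_isUnit (c : ZMod (p ^ 2)) :
    (∃ d, c = (p : ZMod (p ^ 2)) * d) ∨ IsUnit c := by
  obtain ⟨n, rfl⟩ : ∃ n : ℕ, (n : ZMod (p ^ 2)) = c := ⟨c.val, ZMod.natCast_zmod_val c⟩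
  by_cases h : p ∣ n
  · obtain ⟨d, rfl⟩ := h
    exact Or.inl ⟨d, by push_cast; rfl⟩
  · right
    rw [ZMod.isUnit_iff_coprime]
    exact Nat.Coprime.pow_right 2 ((hp.out.coprime_iff_not_dvd.2 h).symm)

theorem ZMod.sq_cast_ne_zero : (p : ZMod (p ^ 2)) ≠ 0 := by
  intro h
  rw [ZMod.natCast_eq_zero_iff] at h
  have := Nat.le_of_dvd hp.out.pos h
  have := hp.out.two_le
  nlinarith

theorem ZMod.exists_of_p_mul_eq_zero {c : ZMod (p ^ 2)} (h : (p : ZMod (p ^ 2)) * c = 0) :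
    ∃ d, c = (p : ZMod (p ^ 2)) * d := by
  rcases ZMod.sq_cast_eq_zero_or_isUnit c with h' | h'
  · exact h'
  · exact absurd ((h'.mul_left_eq_zero).1 h) ZMod.sq_cast_ne_zero

theorem ZMod.isUnit_of_p_mul_ne_zero {c : ZMod (p ^ 2)} (h : (p : ZMod (p ^ 2)) * c ≠ 0) :
    IsUnit c := by
  rcases ZMod.sq_cast_eq_zero_or_isUnit c with ⟨d, rfl⟩ | h'
  · exact absurd (by rw [← mul_assoc, ZMod.sq_cast_mul_cast, zero_mul]) h
  · exact h'

variable (p) in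
/-- The digits `0, 1, …, p - 1` in `ZMod (p ^ 2)`. -/
def digits : Finset (ZMod (p ^ 2)) := (range p).image (fun i : ℕ => (i : ZMod (p ^ 2)))

variable (p) in
/-- The ideal of multiples of `p` in `ZMod (p ^ 2)`. -/
def pMultiples : Finset (ZMod (p ^ 2)) := univ.filter fun c => (p : ZMod (p ^ 2)) * c = 0

theorem mem_pMultiples {c : ZMod (p ^ 2)} : c ∈ pMultiples p ↔ (p : ZMod (p ^ 2)) * c = 0 := by
  simp [pMultiples]

theorem p_mul_mem_pMultiples (c : ZMod (p ^ 2)) : (p : ZMod (p ^ 2)) * c ∈ pMultiples p :=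
  mem_pMultiples.2 (ZMod.p_mul_p_mul c)

theorem p_mul_natCast_eq_iff (i j : ℕ) :
    (p : ZMod (p ^ 2)) * i = p * j ↔ i ≡ j [MOD p] := by
  rw [← Nat.cast_mul, ← Nat.cast_mul, ZMod.natCast_eq_natCast_iff, pow_two]
  exact Nat.ModEq.mul_left_cancel_iff' hp.out.ne_zero

theorem exists_digit (c : ZMod (p ^ 2)) :
    ∃ k ∈ digits p, (p : ZMod (p ^ 2)) * k = (p : ZMod (p ^ 2)) * c := by
  refine ⟨((c.val % p : ℕ) : ZMod (p ^ 2)), ?_, ?_⟩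
  · exact mem_image.2 ⟨_, mem_range.2 (Nat.mod_lt _ hp.out.pos), rfl⟩
  · conv_rhs => rw [← ZMod.natCast_zmod_val c]
    rw [p_mul_natCast_eq_iff]
    exact Nat.mod_modEq _ _

theorem digit_unique {k l : ZMod (p ^ 2)} (hk : k ∈ digits p) (hl : l ∈ digits p)
    (h : (p : ZMod (p ^ 2)) * k = (p : ZMod (p ^ 2)) * l) : k = l := by
  obtain ⟨i, hi, rfl⟩ := mem_image.1 hk
  obtain ⟨j, hj, rfl⟩ := mem_image.1 hl
  rw [p_mul_natCast_eq_iff] at h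
  rw [Nat.ModEq.eq_of_lt_of_lt h (mem_range.1 hi) (mem_range.1 hj)]

theorem card_digits : (digits p).card = p := by
  rw [digits, card_image_of_injOn, card_range]
  intro i hi j hj h
  have h' : (p : ZMod (p ^ 2)) * i = p * j := by
    simp only at h
    rw [h]
  rw [p_mul_natCast_eq_iff] at h'
  exact Nat.ModEq.eq_of_lt_of_lt h' (mem_range.1 hi) (mem_range.1 hj)

theorem card_pMultiples : (pMultiples p).card = p := by
  have : pMultiples p = (digits p).image (fun k => (p : ZMod (p ^ 2)) * k) := by
    ext c
    rw [mem_pMultiples, mem_image]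
    constructor
    · intro h
      obtain ⟨d, rfl⟩ := ZMod.exists_of_p_mul_eq_zero h
      exact exists_digit d
    · rintro ⟨k, -, rfl⟩
      exact ZMod.p_mul_p_mul k
  rw [this, card_image_of_injOn (fun k hk l hl h => digit_unique hk hl h), card_digits]

/-- If `u`, `v` are the pairings of a point with a symplectic basis `s`, `t`, this counts the lifts
`s + c • t` of the direction of `s` mod p whose cyclic group contains the point. When `v` is a unit
the only candidate is `c = -u / v`; when `p ∣ v` the term `c * v` is zero. Correction terms stand on
both sides so that sums over points need no subtraction. -/
theorem card_filter_pMultiples (u v : ZMod (p ^ 2)) :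
    ((pMultiples p).filter fun c => u + c * v = 0).card
        + (if (p : ZMod (p ^ 2)) * u = 0 ∧ (p : ZMod (p ^ 2)) * v = 0 then 1 else 0)
      = (if (p : ZMod (p ^ 2)) * u = 0 then 1 else 0)
        + p * (if (p : ZMod (p ^ 2)) * v = 0 ∧ u = 0 then 1 else 0) := by
  by_cases hv : (p : ZMod (p ^ 2)) * v = 0
  · have h1 : ∀ c ∈ pMultiples p, (u + c * v = 0 ↔ u = 0) := by
      intro c hc
      obtain ⟨d, rfl⟩ := ZMod.exists_of_p_mul_eq_zero (mem_pMultiples.1 hc)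
      rw [mul_right_comm, hv, zero_mul, add_zero]
    rw [filter_congr h1]
    by_cases hu : u = 0
    · simp [hu, hv, card_pMultiples]; ring
    · simp [hu, hv]
  · have hvu := ZMod.isUnit_of_p_mul_ne_zero hv
    obtain ⟨v, rfl⟩ := hvu
    by_cases hu : (p : ZMod (p ^ 2)) * u = 0
    · have : (pMultiples p).filter (fun c => u + c * v = 0) = {-u * (↑v⁻¹ : ZMod (p ^ 2))} := by
        ext c
        simp only [mem_filter, mem_pMultiples, mem_singleton]
        constructor
        · rintro ⟨-, h⟩
          rw [Units.eq_mul_inv_iff_mul_eq]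
          linear_combination h
        · rintro rfl
          refine ⟨?_, by simp⟩
          linear_combination (-↑v⁻¹ : ZMod (p ^ 2)) * hu
      simp [this, hu, hv]
    · have : (pMultiples p).filter (fun c => u + c * v = 0) = ∅ := by
        rw [filter_eq_empty_iff]
        intro c hc h
        rw [mem_pMultiples] at hc
        apply hu
        linear_combination (p : ZMod (p ^ 2)) * h - v * hc
      simp [this, hu, hv]

/-- The directions mod p are those of `s + k • t` for digits `k`, together with `t`. A vector that
is nonzero mod p lies on exactly one of these `p + 1` lines, the zero vector on all of them. -/
theorem card_filter_digits (u v : ZMod (p ^ 2)) :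
    ((digits p).filter fun k => (p : ZMod (p ^ 2)) * (u + k * v) = 0).card
        + (if (p : ZMod (p ^ 2)) * v = 0 then 1 else 0)
      = 1 + p * (if (p : ZMod (p ^ 2)) * u = 0 ∧ (p : ZMod (p ^ 2)) * v = 0 then 1 else 0) := by
  by_cases hv : (p : ZMod (p ^ 2)) * v = 0
  · have h1 : ∀ k ∈ digits p, ((p : ZMod (p ^ 2)) * (u + k * v) = 0
        ↔ (p : ZMod (p ^ 2)) * u = 0) := by
      intro k _
      rw [mul_add, mul_left_comm, hv, mul_zero, add_zero]
    rw [filter_congr h1]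
    by_cases hu : (p : ZMod (p ^ 2)) * u = 0
    · simp [hu, hv, card_digits]; ring
    · simp [hu, hv]
  · have hvu := ZMod.isUnit_of_p_mul_ne_zero hv
    obtain ⟨v, rfl⟩ := hvu
    obtain ⟨k, hk, hk'⟩ := exists_digit (-u * (↑v⁻¹ : ZMod (p ^ 2)))
    have : (digits p).filter (fun k => (p : ZMod (p ^ 2)) * (u + k * v) = 0) = {k} := by
      ext l
      simp only [mem_filter, mem_singleton]
      have hinv : (↑v⁻¹ : ZMod (p ^ 2)) * v = 1 := by simp
      constructor
      · rintro ⟨hl, h⟩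
        refine digit_unique hl hk ?_
        rw [hk']
        linear_combination (↑v⁻¹ : ZMod (p ^ 2)) * h - (p : ZMod (p ^ 2)) * l * hinv
      · rintro rfl
        refine ⟨hk, ?_⟩
        linear_combination (v : ZMod (p ^ 2)) * hk' - p * u * hinv
    simp [this, hv]

end Ring

/-! ### The symplectic form, primitive vectors and parallelism mod p -/

section Symplectic

/-- The group `ℤ/p² × ℤ/p²`. -/
abbrev Plane (p : ℕ) := ZMod (p ^ 2) × ZMod (p ^ 2)

variable {p : ℕ}

/-- The standard symplectic form. -/
def symp (x y : Plane p) : ZMod (p ^ 2) := x.1 * y.2 - x.2 * y.1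

theorem symp_add_left (x y z : Plane p) : symp (x + y) z = symp x z + symp y z := by
  simp only [symp, Prod.fst_add, Prod.snd_add]; ring

theorem symp_sub_left (x y z : Plane p) : symp (x - y) z = symp x z - symp y z := by
  simp only [symp, Prod.fst_sub, Prod.snd_sub]; ring

theorem symp_smul_left (c : ZMod (p ^ 2)) (x y : Plane p) : symp (c • x) y = c * symp x y := by
  simp only [symp, Prod.smul_fst, Prod.smul_snd, smul_eq_mul]; ring

theorem symp_add_right (x y z : Plane p) : symp x (y + z) = symp x y + symp x z := by
  simp only [symp, Prod.fst_add, Prod.snd_add]; ring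

theorem symp_smul_right (c : ZMod (p ^ 2)) (x y : Plane p) : symp x (c • y) = c * symp x y := by
  simp only [symp, Prod.smul_fst, Prod.smul_snd, smul_eq_mul]; ring

theorem symp_self (x : Plane p) : symp x x = 0 := by
  simp only [symp]; ring

theorem symp_swap (x y : Plane p) : symp x y = -symp y x := by
  simp only [symp]; ring

theorem symp_zero_left (x : Plane p) : symp 0 x = 0 := by
  simp [symp]

theorem eq_smul_add_smul {s t : Plane p} (h : symp s t = 1) (y : Plane p) :
    y = symp y t • s - symp y s • t := by
  simp only [symp] at h ⊢
  ext
  · simp only [Prod.fst_sub, Prod.smul_fst, smul_eq_mul]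
    linear_combination (-y.1) * h
  · simp only [Prod.snd_sub, Prod.smul_snd, smul_eq_mul]
    linear_combination (-y.2) * h

theorem eq_zero_iff_symp {s t : Plane p} (h : symp s t = 1) (y : Plane p) :
    y = 0 ↔ symp y s = 0 ∧ symp y t = 0 := by
  constructor
  · rintro rfl
    simp [symp_zero_left]
  · rintro ⟨h1, h2⟩
    rw [eq_smul_add_smul h y, h1, h2]
    simp

theorem p_smul_eq_zero_iff {s t : Plane p} (h : symp s t = 1) (y : Plane p) :
    (p : ZMod (p ^ 2)) • y = 0 ↔
      (p : ZMod (p ^ 2)) * symp y s = 0 ∧ (p : ZMod (p ^ 2)) * symp y t = 0 := by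
  rw [eq_zero_iff_symp h, symp_smul_left, symp_smul_left]

variable [hp : Fact p.Prime]

theorem exists_symp_eq_one {s : Plane p} (hs : (p : ZMod (p ^ 2)) • s ≠ 0) :
    ∃ t, symp s t = 1 := by
  by_cases h : (p : ZMod (p ^ 2)) * s.1 = 0
  · have h2 : (p : ZMod (p ^ 2)) * s.2 ≠ 0 := by
      intro h2
      exact hs (Prod.ext h h2)
    obtain ⟨u, hu⟩ := ZMod.isUnit_of_p_mul_ne_zero h2
    exact ⟨(-(↑u⁻¹ : ZMod (p ^ 2)), 0), by simp [symp, ← hu]⟩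
  · obtain ⟨u, hu⟩ := ZMod.isUnit_of_p_mul_ne_zero h
    exact ⟨(0, (↑u⁻¹ : ZMod (p ^ 2))), by simp [symp, ← hu]⟩

theorem p_smul_ne_zero_of_symp {s t : Plane p} (h : symp s t = 1) :
    (p : ZMod (p ^ 2)) • s ≠ 0 := by
  intro h0
  have := symp_smul_left (p : ZMod (p ^ 2)) s t
  rw [h0, symp_zero_left, h, mul_one] at this
  exact ZMod.sq_cast_ne_zero this.symm

theorem p_smul_p_smul (y : Plane p) :
    (p : ZMod (p ^ 2)) • ((p : ZMod (p ^ 2)) • y) = 0 := by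
  rw [smul_smul, ZMod.sq_cast_mul_cast, zero_smul]

theorem exists_eq_p_smul {y : Plane p} (hy : (p : ZMod (p ^ 2)) • y = 0) :
    ∃ z, y = (p : ZMod (p ^ 2)) • z := by
  obtain ⟨a, ha⟩ := ZMod.exists_of_p_mul_eq_zero (c := y.1) (congrArg Prod.fst hy)
  obtain ⟨b, hb⟩ := ZMod.exists_of_p_mul_eq_zero (c := y.2) (congrArg Prod.snd hy)
  exact ⟨(a, b), Prod.ext ha hb⟩

theorem p_smul_ne_zero_of_isUnit {k : ZMod (p ^ 2)} (hk : IsUnit k) {s : Plane p}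
    (hs : (p : ZMod (p ^ 2)) • s ≠ 0) : (p : ZMod (p ^ 2)) • (k • s) ≠ 0 := by
  rw [smul_comm]
  exact fun h => hs ((hk.smul_eq_zero).1 h)

/-- Two primitive vectors whose symplectic product vanishes mod `p` are proportional mod `p`. -/
theorem exists_unit_p_smul {s s' : Plane p} (hs : (p : ZMod (p ^ 2)) • s ≠ 0)
    (hs' : (p : ZMod (p ^ 2)) • s' ≠ 0) (h : (p : ZMod (p ^ 2)) * symp s' s = 0) :
    ∃ k : ZMod (p ^ 2), IsUnit k ∧ (p : ZMod (p ^ 2)) • s' = (p : ZMod (p ^ 2)) • (k • s) := by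
  obtain ⟨t, ht⟩ := exists_symp_eq_one hs
  have e := eq_smul_add_smul ht s'
  have e' : (p : ZMod (p ^ 2)) • s' = (p : ZMod (p ^ 2)) • (symp s' t • s) := by
    conv_lhs => rw [e]
    rw [smul_sub, smul_smul (p : ZMod (p ^ 2)) (symp s' s), h, zero_smul, sub_zero]
  refine ⟨symp s' t, ?_, e'⟩
  apply ZMod.isUnit_of_p_mul_ne_zero
  intro h0
  rw [e', smul_smul, h0, zero_smul] at hs'
  exact hs' rfl

theorem exists_unit_smul {s s' : Plane p} (hs : (p : ZMod (p ^ 2)) • s ≠ 0)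
    (hs' : (p : ZMod (p ^ 2)) • s' ≠ 0) (h : symp s' s = 0) :
    ∃ k : ZMod (p ^ 2), IsUnit k ∧ s' = k • s := by
  obtain ⟨t, ht⟩ := exists_symp_eq_one hs
  have e := eq_smul_add_smul ht s'
  rw [h, zero_smul, sub_zero] at e
  refine ⟨symp s' t, ?_, e⟩
  apply ZMod.isUnit_of_p_mul_ne_zero
  intro h0
  rw [e, smul_smul, h0, zero_smul] at hs'
  exact hs' rfl

theorem p_mul_symp_iff {s s' : Plane p} (hs : (p : ZMod (p ^ 2)) • s ≠ 0)
    (hs' : (p : ZMod (p ^ 2)) • s' ≠ 0) (h : (p : ZMod (p ^ 2)) * symp s' s = 0) (y : Plane p) :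
    (p : ZMod (p ^ 2)) * symp y s' = 0 ↔ (p : ZMod (p ^ 2)) * symp y s = 0 := by
  obtain ⟨k, hk, e⟩ := exists_unit_p_smul hs hs' h
  rw [← symp_smul_right, e, symp_smul_right, symp_smul_right, mul_left_comm, hk.mul_right_eq_zero]

theorem symp_iff_of_p_smul {s s' : Plane p} (hs : (p : ZMod (p ^ 2)) • s ≠ 0)
    (hs' : (p : ZMod (p ^ 2)) • s' ≠ 0) (h : (p : ZMod (p ^ 2)) * symp s' s = 0) {y : Plane p}
    (hy : (p : ZMod (p ^ 2)) • y = 0) : symp y s' = 0 ↔ symp y s = 0 := by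
  obtain ⟨z, rfl⟩ := exists_eq_p_smul hy
  rw [symp_smul_left, symp_smul_left, p_mul_symp_iff hs hs' h]

end Symplectic

/-! ### Vanishing as equidistribution, and double counting over directions -/

section Counting

variable {p : ℕ}

/-- Number of points of `A` congruent to `x` mod `p`. -/
def fib (A : Finset (Plane p)) (x : Plane p) : ℕ :=
  (A.filter fun a => (p : ZMod (p ^ 2)) • (a - x) = 0).card

/-- Number of points of `A` that lie mod `p` on the line through `x` in direction `s`. -/
def lin (A : Finset (Plane p)) (s x : Plane p) : ℕ :=
  (A.filter fun a => (p : ZMod (p ^ 2)) * symp (a - x) s = 0).card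

/-- Number of points of `A` in the coset through `x` of the cyclic group generated by `s`. -/
def cos (A : Finset (Plane p)) (s x : Plane p) : ℕ :=
  (A.filter fun a => symp (a - x) s = 0).card

/-- Number of points of `A` in the coset through `x` of the group generated by `p • s`. -/
def hco (A : Finset (Plane p)) (s x : Plane p) : ℕ :=
  (A.filter fun a => (p : ZMod (p ^ 2)) • (a - x) = 0 ∧ symp (a - x) s = 0).card

/-- The combinatorial form of the vanishing of the Fourier coefficient of `A` at `s`. -/
def Van (A : Finset (Plane p)) (s : Plane p) : Prop :=
  ∀ c : ZMod (p ^ 2), (A.filter fun a => symp a s = c + p).card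
    = (A.filter fun a => symp a s = c).card

variable [hp : Fact p.Prime] {A : Finset (Plane p)} {s t : Plane p}

theorem Van.add_mul (h : Van A s) (c d : ZMod (p ^ 2)) :
    (A.filter fun a => symp a s = c + p * d).card = (A.filter fun a => symp a s = c).card := by
  obtain ⟨n, rfl⟩ : ∃ n : ℕ, (n : ZMod (p ^ 2)) = d := ⟨d.val, ZMod.natCast_zmod_val d⟩
  induction n with
  | zero => simp
  | succ n ih =>
    have e : c + (p : ZMod (p ^ 2)) * ((n + 1 : ℕ) : ZMod (p ^ 2)) = c + p * n + p := by
      push_cast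
      ring
    rw [← ih, ← h (c + p * n), e]

theorem Van.smul (h : Van A s) {k : ZMod (p ^ 2)} (hk : IsUnit k) : Van A (k • s) := by
  obtain ⟨u, rfl⟩ := hk
  intro c
  have key : ∀ c : ZMod (p ^ 2), (A.filter fun a => symp a ((u : ZMod (p ^ 2)) • s) = c)
      = A.filter fun a => symp a s = ↑u⁻¹ * c := by
    intro c
    refine filter_congr fun a _ => ?_
    rw [symp_smul_right, Units.eq_inv_mul_iff_mul_eq]
  rw [key, key, mul_add, mul_comm _ (p : ZMod (p ^ 2)), h.add_mul]

theorem van_smul_iff {k : ZMod (p ^ 2)} (hk : IsUnit k) : Van A (k • s) ↔ Van A s := by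
  refine ⟨fun h => ?_, fun h => h.smul hk⟩
  obtain ⟨u, rfl⟩ := hk
  have := h.smul (k := ↑u⁻¹) (Units.isUnit _)
  rwa [smul_smul, Units.inv_mul, one_smul] at this

/-- A line mod p is the union of `p` level sets of `symp · s` whose levels differ by multiples of
`p`; periodicity makes them equally large. -/
theorem Van.p_mul_cos (h : Van A s) (x : Plane p) : p * cos A s x = lin A s x := by
  have hm : ∀ a ∈ A.filter (fun a => (p : ZMod (p ^ 2)) * symp (a - x) s = 0),
      symp (a - x) s ∈ pMultiples p := fun a ha => mem_pMultiples.2 (mem_filter.1 ha).2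
  rw [lin, card_eq_sum_card_fiberwise hm]
  have : ∀ c ∈ pMultiples p, ((A.filter (fun a => (p : ZMod (p ^ 2)) * symp (a - x) s = 0)).filter
      fun a => symp (a - x) s = c).card = cos A s x := by
    intro c hc
    obtain ⟨d, rfl⟩ := ZMod.exists_of_p_mul_eq_zero (mem_pMultiples.1 hc)
    rw [filter_filter]
    have e1 : (A.filter fun a => (p : ZMod (p ^ 2)) * symp (a - x) s = 0 ∧
        symp (a - x) s = (p : ZMod (p ^ 2)) * d)
        = A.filter fun a => symp a s = symp x s + p * d := by
      refine filter_congr fun a _ => ?_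
      rw [symp_sub_left]
      constructor
      · rintro ⟨-, h⟩
        linear_combination h
      · intro h
        have : symp a s - symp x s = (p : ZMod (p ^ 2)) * d := by linear_combination h
        exact ⟨by rw [this, ZMod.p_mul_p_mul], this⟩
    rw [e1, h.add_mul, cos]
    simp only [symp_sub_left, sub_eq_zero]
  rw [sum_congr rfl this, sum_const, card_pMultiples, smul_eq_mul]

theorem Van.p_mul_lin (h : Van A ((p : ZMod (p ^ 2)) • s)) (x : Plane p) :
    p * lin A s x = A.card := by
  have := h.p_mul_cos x
  simp only [cos, lin, symp_smul_right, ZMod.p_mul_p_mul] at this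
  rw [lin, this]
  simp

theorem van_iff_of_symp_eq_zero {s' : Plane p} (hs : (p : ZMod (p ^ 2)) • s ≠ 0)
    (hs' : (p : ZMod (p ^ 2)) • s' ≠ 0) (h : symp s' s = 0) : Van A s' ↔ Van A s := by
  obtain ⟨k, hk, rfl⟩ := exists_unit_smul hs hs' h
  exact van_smul_iff hk

theorem van_p_smul_iff {s' : Plane p} (hs : (p : ZMod (p ^ 2)) • s ≠ 0)
    (hs' : (p : ZMod (p ^ 2)) • s' ≠ 0) (h : (p : ZMod (p ^ 2)) * symp s' s = 0) :
    Van A ((p : ZMod (p ^ 2)) • s') ↔ Van A ((p : ZMod (p ^ 2)) • s) := by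
  obtain ⟨k, hk, e⟩ := exists_unit_p_smul hs hs' h
  rw [e, smul_comm, van_smul_iff hk]

/-- Double counting over the cyclic subgroups lying above one direction mod p;
`card_filter_pMultiples` gives the weight of each point. -/
theorem sum_cos_add_fib (h : symp s t = 1) (x : Plane p) :
    ∑ c ∈ pMultiples p, cos A (s + c • t) x + fib A x = lin A s x + p * hco A s x := by
  simp only [cos, fib, lin, hco, card_filter]
  rw [sum_comm, ← sum_add_distrib, mul_sum, ← sum_add_distrib]
  refine sum_congr rfl fun a _ => ?_
  have := card_filter_pMultiples (symp (a - x) s) (symp (a - x) t)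
  rw [card_filter] at this
  simp only [symp_add_right, symp_smul_right, p_smul_eq_zero_iff h]
  rw [this]
  congr 2
  refine if_congr ?_ rfl rfl
  constructor
  · rintro ⟨h1, h2⟩
    exact ⟨⟨by rw [h2, mul_zero], h1⟩, h2⟩
  · rintro ⟨⟨-, h1⟩, h2⟩
    exact ⟨h1, h2⟩

theorem sum_lin_add_lin (h : symp s t = 1) (x : Plane p) :
    ∑ k ∈ digits p, lin A (s + k • t) x + lin A t x = A.card + p * fib A x := by
  rw [card_eq_sum_ones]
  simp only [fib, lin, card_filter]
  rw [sum_comm, ← sum_add_distrib, mul_sum, ← sum_add_distrib]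
  refine sum_congr rfl fun a _ => ?_
  have := card_filter_digits (symp (a - x) s) (symp (a - x) t)
  rw [card_filter] at this
  simp only [symp_add_right, symp_smul_right, p_smul_eq_zero_iff h]
  rw [this]

/-- The count of lines through a point again, inside one fibre: its differences have the form `p •
z`, and `z` mod p plays the role of the vector. -/
theorem sum_hco_add_hco (h : symp s t = 1) (x : Plane p) :
    ∑ k ∈ digits p, hco A (s + k • t) x + hco A t x = fib A x + p * (if x ∈ A then 1 else 0) := by
  have e : (if x ∈ A then 1 else 0) = ∑ a ∈ A, if a - x = 0 then 1 else 0 := by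
    simp [sub_eq_zero]
  rw [e]
  simp only [fib, hco, card_filter]
  rw [sum_comm, ← sum_add_distrib, mul_sum, ← sum_add_distrib]
  refine sum_congr rfl fun a _ => ?_
  by_cases hy : (p : ZMod (p ^ 2)) • (a - x) = 0
  · obtain ⟨z, hz⟩ := exists_eq_p_smul hy
    rw [hz]
    have := card_filter_digits (symp z s) (symp z t)
    rw [card_filter] at this
    simp only [symp_add_right, symp_smul_right, symp_smul_left, p_smul_p_smul, true_and,
      if_true, p_smul_eq_zero_iff h]
    rw [← this]
    simp only [mul_add, mul_left_comm]
  · have : a - x ≠ 0 := by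
      intro h0
      rw [h0, smul_zero] at hy
      exact hy rfl
    simp [hy, this]

theorem lin_congr {s' : Plane p} (hs : (p : ZMod (p ^ 2)) • s ≠ 0)
    (hs' : (p : ZMod (p ^ 2)) • s' ≠ 0) (h : (p : ZMod (p ^ 2)) * symp s' s = 0) (x : Plane p) :
    lin A s' x = lin A s x := by
  simp only [lin, p_mul_symp_iff hs hs' h]

theorem hco_congr {s' : Plane p} (hs : (p : ZMod (p ^ 2)) • s ≠ 0)
    (hs' : (p : ZMod (p ^ 2)) • s' ≠ 0) (h : (p : ZMod (p ^ 2)) * symp s' s = 0) (x : Plane p) :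
    hco A s' x = hco A s x := by
  rw [hco, hco]
  congr 1
  refine filter_congr fun a _ => ?_
  constructor
  · rintro ⟨h1, h2⟩
    exact ⟨h1, (symp_iff_of_p_smul hs hs' h h1).1 h2⟩
  · rintro ⟨h1, h2⟩
    exact ⟨h1, (symp_iff_of_p_smul hs hs' h h1).2 h2⟩

/-- If all Fourier coefficients over the direction `s` vanish, `A` is equidistributed over the
cosets of `⟨p • s⟩` in each fibre. -/
theorem fib_eq_p_mul_hco (hs : (p : ZMod (p ^ 2)) • s ≠ 0)
    (hv : ∀ s' : Plane p, (p : ZMod (p ^ 2)) • s' ≠ 0 → (p : ZMod (p ^ 2)) * symp s' s = 0 →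
      Van A s') (x : Plane p) : fib A x = p * hco A s x := by
  obtain ⟨t, ht⟩ := exists_symp_eq_one hs
  have h1 := sum_cos_add_fib (A := A) ht x
  -- Each of the `p` lifts of the direction takes the share `1 / p` of the same line mod p, so the
  -- coset counts add up to `lin A s x` and cancel it in `h1`.
  have h2 : p * ∑ c ∈ pMultiples p, cos A (s + c • t) x = p * lin A s x := by
    rw [mul_sum]
    have : ∀ c ∈ pMultiples p, p * cos A (s + c • t) x = lin A s x := by
      intro c hc
      rw [mem_pMultiples] at hc
      have e : (p : ZMod (p ^ 2)) • (s + c • t) = (p : ZMod (p ^ 2)) • s := by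
        rw [smul_add, smul_smul, hc, zero_smul, add_zero]
      have h3 : (p : ZMod (p ^ 2)) * symp (s + c • t) s = 0 := by
        rw [← symp_smul_left, e, symp_smul_left, symp_self, mul_zero]
      have h4 : (p : ZMod (p ^ 2)) • (s + c • t) ≠ 0 := by rwa [e]
      rw [(hv _ h4 h3).p_mul_cos, lin_congr hs h4 h3]
    rw [sum_congr rfl this, sum_const, card_pMultiples, smul_eq_mul]
  have := Nat.eq_of_mul_eq_mul_left hp.out.pos h2
  omega

theorem symp_add_smul_self (h : symp s t = 1) (k : ZMod (p ^ 2)) : symp (s + k • t) t = 1 := by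
  rw [symp_add_left, symp_smul_left, symp_self, mul_zero, add_zero, h]

theorem p_smul_ne_zero_of_symp' (h : symp s t = 1) : (p : ZMod (p ^ 2)) • t ≠ 0 := by
  intro h0
  have := symp_smul_right (p : ZMod (p ^ 2)) s t
  rw [h0, h, mul_one] at this
  apply ZMod.sq_cast_ne_zero (p := p)
  rw [← this]
  simp [symp]

theorem exists_basis (p : ℕ) : ∃ s t : Plane p, symp s t = 1 :=
  ⟨(1, 0), (0, 1), by simp [symp]⟩

/-- Each of the `p + 1` lines mod p through `x` carries `#A / p` points, and only the fibre of `x`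
is counted more than once. -/
theorem card_eq_p_sq_mul_fib
    (hv : ∀ s : Plane p, (p : ZMod (p ^ 2)) • s ≠ 0 → Van A ((p : ZMod (p ^ 2)) • s))
    (x : Plane p) : A.card = p ^ 2 * fib A x := by
  obtain ⟨s, t, h⟩ := exists_basis p
  have h1 := sum_lin_add_lin (A := A) h x
  have h2 : p * ∑ k ∈ digits p, lin A (s + k • t) x = p * A.card := by
    rw [mul_sum, sum_congr rfl fun k _ => (hv _ (p_smul_ne_zero_of_symp
      (symp_add_smul_self h k))).p_mul_lin x, sum_const, card_digits, smul_eq_mul]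
  have h3 := (hv t (p_smul_ne_zero_of_symp' h)).p_mul_lin x
  have h4 := congrArg (p * ·) h1
  simp only [mul_add] at h4
  rw [h2, h3] at h4
  linarith

/-- If all Fourier coefficients outside the direction `t` vanish, `A` is a union of cosets of
`⟨p • t⟩`. -/
theorem hco_eq_of_van_off (ht : (p : ZMod (p ^ 2)) • t ≠ 0)
    (hv : ∀ s' : Plane p, (p : ZMod (p ^ 2)) * symp s' t ≠ 0 → Van A s') (x : Plane p) :
    hco A t x = p * (if x ∈ A then 1 else 0) := by
  obtain ⟨s, h⟩ : ∃ s, symp s t = 1 := by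
    obtain ⟨s, hs⟩ := exists_symp_eq_one ht
    exact ⟨(-1 : ZMod (p ^ 2)) • s, by rw [symp_smul_left, symp_swap, hs]; ring⟩
  have h1 := sum_hco_add_hco (A := A) h x
  -- Each direction other than `t` has `hco = fib / p`; the `p` of them exhaust `fib A x` in `h1`
  -- and leave the term of `t`.
  have h2 : p * ∑ k ∈ digits p, hco A (s + k • t) x = p * fib A x := by
    rw [mul_sum]
    have : ∀ k ∈ digits p, p * hco A (s + k • t) x = fib A x := by
      intro k _
      have hk := symp_add_smul_self h k
      refine (fib_eq_p_mul_hco (p_smul_ne_zero_of_symp hk) (fun s' hs' hss' => hv s' ?_) x).symm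
      intro h0
      have h5 := (p_mul_symp_iff (p_smul_ne_zero_of_symp hk) hs' hss' t).1
        (by rw [symp_swap, mul_neg, h0, neg_zero])
      rw [symp_swap, hk, mul_neg, mul_one, neg_eq_zero] at h5
      exact ZMod.sq_cast_ne_zero h5
    rw [sum_congr rfl this, sum_const, card_digits, smul_eq_mul]
  have := Nat.eq_of_mul_eq_mul_left hp.out.pos h2
  omega

theorem prim_of_p_mul_symp_ne_zero (h : (p : ZMod (p ^ 2)) * symp s t ≠ 0) :
    (p : ZMod (p ^ 2)) • s ≠ 0 := by
  intro h0
  rw [← symp_smul_left, h0, symp_zero_left] at h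
  exact h rfl

/-- The two preceding equidistribution results each contribute a factor `p`, so a fibre that meets
`A` is full. -/
theorem fib_eq_of_van_prim (hv : ∀ s : Plane p, (p : ZMod (p ^ 2)) • s ≠ 0 → Van A s)
    (x : Plane p) : fib A x = p ^ 2 * (if x ∈ A then 1 else 0) := by
  obtain ⟨s, t, h⟩ := exists_basis p
  have ht := p_smul_ne_zero_of_symp' h
  rw [fib_eq_p_mul_hco ht (fun s' hs' _ => hv s' hs'),
    hco_eq_of_van_off ht (fun s' hs' => hv s' (prim_of_p_mul_symp_ne_zero hs'))]
  ring

theorem fib_congr {x y : Plane p} (h : (p : ZMod (p ^ 2)) • (x - y) = 0) : fib A x = fib A y := by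
  rw [fib, fib]
  congr 1
  refine filter_congr fun a _ => ?_
  have : a - y = (a - x) + (x - y) := by abel
  rw [this, smul_add, h, add_zero]

theorem add_mem_of_van_prim (hv : ∀ s : Plane p, (p : ZMod (p ^ 2)) • s ≠ 0 → Van A s)
    {x y : Plane p} (hx : x ∈ A) (hy : (p : ZMod (p ^ 2)) • y = 0) : x + y ∈ A := by
  have h1 := fib_eq_of_van_prim hv x
  have h2 := fib_eq_of_van_prim hv (x + y)
  rw [fib_congr (y := x) (by rwa [add_sub_cancel_left]), h1, if_pos hx] at h2
  by_contra h
  rw [if_neg h] at h2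
  simp [hp.out.ne_zero] at h2

end Counting

/-! ### Fourier coefficients, spectra and tilings in terms of `Van` -/

section Fourier

open Polynomial in
-- Write `P = Φ * Q` with `Φ` the cyclotomic polynomial. Since `(X ^ p - 1) * Φ = X ^ (p ^ 2) - 1`,
-- the product `(X ^ p - 1) * P` equals `(X ^ (p ^ 2) - 1) * Q`. As `Q` has degree less than `p`,
-- this has no terms in degrees from `p` to `p ^ 2 - 1`.
theorem Polynomial.coeff_add_p_of_cyclotomic_dvd {p : ℕ} [hp : Fact p.Prime] {P : ℚ[X]}
    (hdeg : P.natDegree < p ^ 2) (hdvd : cyclotomic (p ^ 2) ℚ ∣ P) {j : ℕ} (hj : j + p < p ^ 2) :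
    P.coeff (j + p) = P.coeff j := by
  obtain ⟨Q, rfl⟩ := hdvd
  by_cases hQ : Q = 0
  · simp [hQ]
  have hQdeg : Q.natDegree < p := by
    rw [natDegree_mul (cyclotomic_ne_zero _ _) hQ, natDegree_cyclotomic,
      Nat.totient_prime_pow hp.out (by norm_num)] at hdeg
    obtain ⟨q, hq⟩ : ∃ q, p = q + 1 := ⟨p - 1, by have := hp.out.pos; omega⟩
    rw [hq] at hdeg ⊢
    simp only [Nat.add_sub_cancel] at hdeg
    norm_num at hdeg
    nlinarith
  have key : (X ^ p - 1) * (cyclotomic (p ^ 2) ℚ * Q) = (X ^ (p ^ 2) - 1) * Q := by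
    have h1 := cyclotomic_prime_pow_eq_geom_sum (R := ℚ) (n := 1) hp.out
    have h2 := geom_sum_mul (X ^ p : ℚ[X]) p
    rw [pow_one] at h1
    rw [← mul_assoc, mul_comm (X ^ p - 1), show p ^ 2 = p ^ (1 + 1) from rfl, h1, h2, ← pow_mul,
      pow_succ, pow_one]
  have h := congrArg (fun P => coeff P (j + p)) key
  simp only [sub_mul, one_mul, coeff_sub, coeff_X_pow_mul] at h
  rw [coeff_X_pow_mul', if_neg (by omega), coeff_eq_zero_of_natDegree_lt (p := Q) (by omega)] at h
  linarith

variable {p : ℕ} [hp : Fact p.Prime]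

theorem stdAddChar_p_ne_one : ZMod.stdAddChar (N := p ^ 2) (p : ZMod (p ^ 2)) ≠ 1 := by
  intro h
  rw [← AddChar.map_zero_eq_one (ZMod.stdAddChar (N := p ^ 2))] at h
  exact ZMod.sq_cast_ne_zero (ZMod.injective_stdAddChar h)

theorem stdAddChar_natCast (j : ℕ) : ZMod.stdAddChar (N := p ^ 2) (j : ZMod (p ^ 2))
    = Complex.exp (2 * Real.pi * Complex.I / (p ^ 2 : ℕ)) ^ j := by
  have := ZMod.stdAddChar_coe (N := p ^ 2) (j : ℤ)
  rw [Int.cast_natCast] at this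
  rw [this, ← Complex.exp_nat_mul]
  congr 1
  push_cast
  ring

open Polynomial in
/-- A sum of `p²`-th roots of unity with multiplicities `N` vanishes if and only if `N` is
`p`-periodic. -/
theorem sum_stdAddChar_eq_zero_iff (N : ZMod (p ^ 2) → ℕ) :
    ∑ c, (N c : ℂ) * ZMod.stdAddChar c = 0 ↔ ∀ c, N (c + (p : ZMod (p ^ 2))) = N c := by
  constructor
  · intro h
    set P : ℚ[X] := ∑ i ∈ range (p ^ 2), C (N (i : ZMod (p ^ 2)) : ℚ) * X ^ i with hP
    have hcoeff : ∀ j, j < p ^ 2 → P.coeff j = N (j : ZMod (p ^ 2)) := by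
      intro j hj
      rw [hP, finsetSum_coeff]
      simp [coeff_X_pow, hj]
    have hsq : 0 < p ^ 2 := pow_pos hp.out.pos 2
    have hdeg : P.natDegree < p ^ 2 := by
      have : P.natDegree ≤ p ^ 2 - 1 := by
        refine natDegree_sum_le_of_forall_le _ _ fun i hi => ?_
        rw [mem_range] at hi
        exact (natDegree_C_mul_X_pow_le _ _).trans (by omega)
      omega
    have hdvd : cyclotomic (p ^ 2) ℚ ∣ P := by
      rw [cyclotomic_eq_minpoly_rat (Complex.isPrimitiveRoot_exp (p ^ 2) hsq.ne') hsq]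
      refine minpoly.dvd _ _ ?_
      rw [hP, map_sum, ← h]
      have e : ∑ c : ZMod (p ^ 2), (N c : ℂ) * ZMod.stdAddChar c
          = ∑ i ∈ range (p ^ 2), (N (i : ZMod (p ^ 2)) : ℂ) *
            ZMod.stdAddChar (N := p ^ 2) (i : ZMod (p ^ 2)) := by
        symm
        refine sum_bij (fun i _ => (i : ZMod (p ^ 2))) (fun _ _ => mem_univ _) ?_ ?_
          (fun _ _ => rfl)
        · intro i hi j hj hij
          rw [ZMod.natCast_eq_natCast_iff] at hij
          exact Nat.ModEq.eq_of_lt_of_lt hij (mem_range.1 hi) (mem_range.1 hj)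
        · intro c _
          exact ⟨c.val, mem_range.2 (ZMod.val_lt c), ZMod.natCast_zmod_val c⟩
      rw [e]
      refine sum_congr rfl fun i _ => ?_
      rw [stdAddChar_natCast]
      simp
    have hstep : ∀ j : ℕ, j + p < p ^ 2 →
        N ((j + p : ℕ) : ZMod (p ^ 2)) = N (j : ZMod (p ^ 2)) := by
      intro j hj
      have := coeff_add_p_of_cyclotomic_dvd hdeg hdvd hj
      rw [hcoeff _ hj, hcoeff _ (by omega)] at this
      exact_mod_cast this
    have hmul : ∀ i r : ℕ, r + p * i < p ^ 2 →
        N ((r + p * i : ℕ) : ZMod (p ^ 2)) = N (r : ZMod (p ^ 2)) := by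
      intro i r
      induction i with
      | zero => simp
      | succ i ih =>
        intro hi
        have e : r + p * (i + 1) = r + p * i + p := by ring
        rw [e] at hi ⊢
        rw [hstep _ hi, ih (by omega)]
    have hmod : ∀ j : ℕ, j < p ^ 2 → N (j : ZMod (p ^ 2)) = N ((j % p : ℕ) : ZMod (p ^ 2)) := by
      intro j hj
      have := hmul (j / p) (j % p) (by rwa [Nat.mod_add_div])
      rwa [Nat.mod_add_div] at this
    intro c
    rw [← ZMod.natCast_zmod_val (c + (p : ZMod (p ^ 2))), ← ZMod.natCast_zmod_val c,
      hmod _ (ZMod.val_lt _), hmod _ (ZMod.val_lt _)]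
    congr 2
    rw [ZMod.natCast_zmod_val, ZMod.val_add, ZMod.val_natCast]
    rw [Nat.mod_mod_of_dvd _ (dvd_pow_self p (by norm_num)), Nat.add_mod,
      Nat.mod_mod_of_dvd _ (dvd_pow_self p (by norm_num))]
    simp
  · intro h
    -- Translation by `p` fixes `N` and multiplies the sum by a root of unity different from 1.
    have e : ∑ c, (N c : ℂ) * ZMod.stdAddChar c
        = ZMod.stdAddChar (p : ZMod (p ^ 2)) * ∑ c, (N c : ℂ) * ZMod.stdAddChar c := by
      conv_lhs => rw [← Equiv.sum_comp (Equiv.addRight (p : ZMod (p ^ 2)))]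
      rw [mul_sum]
      refine sum_congr rfl fun c _ => ?_
      simp only [Equiv.coe_addRight]
      rw [h, AddChar.map_add_eq_mul]
      ring
    have h0 : (1 - ZMod.stdAddChar (p : ZMod (p ^ 2)))
        * ∑ c, (N c : ℂ) * ZMod.stdAddChar c = 0 := by
      rw [sub_mul, one_mul, ← e, sub_self]
    exact (mul_eq_zero.1 h0).resolve_left (sub_ne_zero.2 (Ne.symm stdAddChar_p_ne_one))

/-- The symplectic Fourier transform of the indicator function of `A`. -/
noncomputable def sympFourier (A : Finset (Plane p)) (s : Plane p) : ℂ :=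
  ∑ a ∈ A, ZMod.stdAddChar (symp a s)

theorem sympFourier_eq_zero_iff {A : Finset (Plane p)} {s : Plane p} :
    sympFourier A s = 0 ↔ Van A s := by
  rw [Van, ← sum_stdAddChar_eq_zero_iff fun c => (A.filter fun a => symp a s = c).card, sympFourier,
    ← sum_fiberwise A fun a => symp a s]
  refine Eq.congr (sum_congr rfl fun c _ => ?_) rfl
  rw [← nsmul_eq_mul, ← sum_const]
  exact sum_congr rfl fun a ha => by rw [(mem_filter.1 ha).2]

/-- Orthogonality of the exponentials with frequencies in `S` over `A`. -/
def Orth (A S : Finset (Plane p)) : Prop := ∀ a ∈ S, ∀ b ∈ S, a ≠ b → Van A (a - b)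

theorem symp_zero_right (x : Plane p) : symp x 0 = 0 := by
  simp [symp]

/-- Rotation, which turns the Euclidean pairing into the symplectic one. -/
def rot (p : ℕ) : Plane p ≃+ Plane p where
  toFun s := (-s.2, s.1)
  invFun s := (s.2, -s.1)
  left_inv s := by simp
  right_inv s := by simp
  map_add' s t := by ext <;> simp [add_comm]

theorem symp_rot (a s : Plane p) : symp a (rot p s) = s.1 * a.1 + s.2 * a.2 := by
  simp only [symp, rot, AddEquiv.coe_mk, Equiv.coe_fn_mk]
  ring

theorem inner_expOn (A : Finset (Plane p)) (s t : Plane p) :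
    inner ℂ (expOn A s) (expOn A t) = sympFourier A (rot p t - rot p s) := by
  rw [PiLp.inner_apply, sympFourier, ← sum_coe_sort A]
  refine sum_congr rfl fun a _ => ?_
  simp only [expOn, RCLike.inner_apply]
  rw [← AddChar.map_neg_eq_conj, ← AddChar.map_add_eq_mul, ← map_sub, symp_rot]
  congr 1
  simp only [Prod.fst_sub, Prod.snd_sub]
  ring

/-- Orthogonal nonzero vectors are independent, so being a basis reduces to having the right number
of frequencies. -/
theorem isSpectral_iff {A : Finset (Plane p)} (hA : A.Nonempty) :
    IsSpectral A ↔ ∃ S : Finset (Plane p), S.card = A.card ∧ Orth A S := by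
  constructor
  · rintro ⟨S, horth, hli, hspan⟩
    refine ⟨S.map (rot p).toEquiv.toEmbedding, ?_, ?_⟩
    · rw [card_map]
      have := Module.finrank_eq_card_basis (Module.Basis.mk hli hspan.ge)
      simpa using this.symm
    · intro a ha b hb hab
      rw [mem_map] at ha hb
      obtain ⟨s, hs, rfl⟩ := ha
      obtain ⟨t, ht, rfl⟩ := hb
      rw [← sympFourier_eq_zero_iff]
      exact (inner_expOn A t s).symm.trans (horth t ht s hs fun h => hab (by rw [h]))
  · rintro ⟨S, hcard, horth⟩
    set T := S.map (rot p).symm.toEquiv.toEmbedding with hT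
    have hTS : ∀ s ∈ T, rot p s ∈ S := by
      intro s hs
      obtain ⟨t, ht, rfl⟩ := mem_map.1 hs
      have : rot p ((rot p).symm t) = t := (rot p).apply_symm_apply t
      exact this.symm ▸ ht
    have ho : ∀ s ∈ T, ∀ t ∈ T, s ≠ t → inner ℂ (expOn A s) (expOn A t) = 0 := by
      intro s hs t ht hst
      rw [inner_expOn, sympFourier_eq_zero_iff]
      exact horth _ (hTS t ht) _ (hTS s hs) fun h => hst ((rot p).injective h).symm
    have hli : LinearIndependent ℂ fun s : T => expOn A s.1 := by
      refine linearIndependent_of_ne_zero_of_inner_eq_zero ?_ ?_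
      · intro s h
        have h1 := inner_expOn A s.1 s.1
        rw [h, inner_zero_left, sub_self, sympFourier] at h1
        simp only [symp_zero_right, AddChar.map_zero_eq_one, sum_const, nsmul_eq_mul,
          mul_one] at h1
        exact hA.card_pos.ne (by exact_mod_cast h1)
      · intro s t hst
        exact ho s s.2 t t.2 fun h => hst (Subtype.ext h)
    refine ⟨T, ho, hli, ?_⟩
    refine hli.span_eq_top_of_card_eq_finrank' ?_
    rw [Fintype.card_coe, hT, card_map, hcard]
    simp

/-- The square character matrix has orthogonal rows; a one-sided inverse is two-sided, so its
columns are orthogonal too. -/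
theorem Orth.symm {A S : Finset (Plane p)} (h : Orth A S) (hcard : S.card = A.card)
    (hA : A.Nonempty) : Orth S A := by
  have hn : (A.card : ℂ) ≠ 0 := by exact_mod_cast hA.card_pos.ne'
  let M : Matrix S A ℂ := fun s a => ZMod.stdAddChar (symp a.1 s.1)
  let N : Matrix A S ℂ := fun a s => ZMod.stdAddChar (-symp a.1 s.1) / A.card
  have h1 : M * N = 1 := by
    ext s t
    rw [Matrix.mul_apply]
    have e : ∑ a : A, M s a * N a t = sympFourier A (s.1 - t.1) / A.card := by
      rw [sympFourier, ← sum_coe_sort A, sum_div]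
      refine sum_congr rfl fun a _ => ?_
      simp only [M, N]
      rw [mul_div_assoc', ← AddChar.map_add_eq_mul]
      congr 2
      simp only [symp, Prod.fst_sub, Prod.snd_sub]
      ring
    rw [e]
    by_cases hst : s = t
    · subst hst
      rw [Matrix.one_apply_eq, sub_self, sympFourier]
      simp [symp, hn]
    · rw [Matrix.one_apply_ne hst, sympFourier_eq_zero_iff.2
        (h _ s.2 _ t.2 fun h => hst (Subtype.ext h)), zero_div]
  have h2 : N * M = 1 := by
    rw [Matrix.mul_eq_one_comm_of_card_eq] at h1
    · exact h1
    · simp [hcard]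
  intro a ha b hb hab
  rw [← sympFourier_eq_zero_iff]
  have h3 := congrFun (congrFun h2 ⟨a, ha⟩) ⟨b, hb⟩
  rw [Matrix.one_apply_ne (fun h => hab (congrArg Subtype.val h)), Matrix.mul_apply] at h3
  have e : ∑ s : S, N ⟨a, ha⟩ s * M s ⟨b, hb⟩ = sympFourier S (a - b) / A.card := by
    rw [sympFourier, ← sum_coe_sort S, sum_div]
    refine sum_congr rfl fun s _ => ?_
    simp only [M, N]
    rw [div_mul_eq_mul_div, ← AddChar.map_add_eq_mul]
    congr 2
    simp only [symp, Prod.fst_sub, Prod.snd_sub]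
    ring
  rw [e] at h3
  exact (div_eq_zero_iff.1 h3).resolve_right hn

theorem exists_symp_ne_zero {s : Plane p} (hs : s ≠ 0) : ∃ g, symp g s ≠ 0 := by
  by_contra! h
  have h1 := h (1, 0)
  have h2 := h (0, 1)
  simp only [symp] at h1 h2
  exact hs (Prod.ext (by simpa using h2) (by simpa using h1))

theorem sympFourier_univ {s : Plane p} (hs : s ≠ 0) : sympFourier (univ : Finset (Plane p)) s = 0 := by
  obtain ⟨g, hg⟩ := exists_symp_ne_zero hs
  have e : sympFourier (univ : Finset (Plane p)) s
      = ZMod.stdAddChar (symp g s) * sympFourier (univ : Finset (Plane p)) s := by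
    conv_lhs => rw [sympFourier, ← Equiv.sum_comp (Equiv.addRight g)]
    rw [sympFourier, mul_sum]
    refine sum_congr rfl fun c _ => ?_
    rw [Equiv.coe_addRight, symp_add_left, AddChar.map_add_eq_mul, mul_comm]
  have hne : ZMod.stdAddChar (symp g s) ≠ 1 := by
    intro h
    rw [← AddChar.map_zero_eq_one (ZMod.stdAddChar (N := p ^ 2))] at h
    exact hg (ZMod.injective_stdAddChar h)
  have h0 : (1 - ZMod.stdAddChar (symp g s)) * sympFourier (univ : Finset (Plane p)) s = 0 := by
    rw [sub_mul, one_mul, ← e, sub_self]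
  exact (mul_eq_zero.1 h0).resolve_left (sub_ne_zero.2 (Ne.symm hne))

theorem card_plane : Fintype.card (Plane p) = p ^ 4 := by
  rw [Fintype.card_prod, ZMod.card]
  ring

/-- The transforms of `A` and `B` multiply to that of the whole group, which vanishes away from 0.
-/
theorem IsTile.exists_complement {A : Finset (Plane p)} (h : IsTile A) :
    ∃ B : Finset (Plane p), A.card * B.card = p ^ 4 ∧ ∀ s, s ≠ 0 → Van A s ∨ Van B s := by
  obtain ⟨B, hB⟩ := h
  let e : A × B ≃ Plane p := Equiv.ofBijective (fun x => x.1.1 + x.2.1) hB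
  refine ⟨B, ?_, ?_⟩
  · have := Fintype.card_congr e
    rw [card_plane, Fintype.card_prod] at this
    simpa using this
  · intro s hs
    rw [← sympFourier_eq_zero_iff, ← sympFourier_eq_zero_iff, ← mul_eq_zero, ← sympFourier_univ hs]
    simp only [sympFourier]
    rw [← Equiv.sum_comp e, Fintype.sum_prod_type, ← sum_coe_sort A, ← sum_coe_sort B, sum_mul]
    refine sum_congr rfl fun a _ => ?_
    rw [mul_sum]
    refine sum_congr rfl fun b _ => ?_
    rw [← AddChar.map_add_eq_mul, ← symp_add_left]
    rfl

theorem isTile_of_card_mul {A B : Finset (Plane p)} (hcard : A.card * B.card = p ^ 4)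
    (h : ∀ a ∈ A, ∀ a' ∈ A, ∀ b ∈ B, ∀ b' ∈ B, a - a' = b - b' → a = a') : IsTile A := by
  refine ⟨B, ?_⟩
  have hinj : Function.Injective fun x : ((A : Set (Plane p)) : Type) × ((B : Set (Plane p)) : Type) =>
      x.1.1 + x.2.1 := by
    rintro ⟨⟨a, ha⟩, ⟨b, hb⟩⟩ ⟨⟨a', ha'⟩, ⟨b', hb'⟩⟩ hab
    simp only at hab
    have haa := h a ha a' ha' b' hb' b hb (by
      rw [sub_eq_sub_iff_add_eq_add, hab, add_comm])
    subst haa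
    have hbb := add_left_cancel hab
    subst hbb
    rfl
  have := (Fintype.bijective_iff_injective_and_card
    fun x : ((A : Set (Plane p)) : Type) × ((B : Set (Plane p)) : Type) => x.1.1 + x.2.1).2
    ⟨hinj, by rw [card_plane, Fintype.card_prod, ← hcard]; simp⟩
  exact this

end Fourier

/-! ### Size bounds, divisibility and pigeonhole for fibres, lines and cosets -/

section Bounds

variable {p : ℕ} [hp : Fact p.Prime] {A : Finset (Plane p)} {s t x : Plane p}

/-- The image of `A` under `g` is large, and `f` refines `g`, so `g` refines `f`. -/
theorem Finset.eq_of_refines {α β γ : Type*} [DecidableEq β] [DecidableEq γ] {F : Finset α}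
    {f : α → β} {g : α → γ} (h : ∀ a ∈ F, ∀ b ∈ F, f a = f b → g a = g b)
    (hcard : (F.image f).card ≤ (F.image g).card) {a b : α} (ha : a ∈ F) (hb : b ∈ F)
    (hab : g a = g b) : f a = f b := by
  classical
  set P := F.image fun a => (f a, g a) with hP
  have h1 : P.card ≤ (F.image f).card := by
    refine card_le_card_of_injOn Prod.fst ?_ ?_
    · intro q hq
      obtain ⟨a, ha, rfl⟩ := mem_image.1 (mem_coe.1 hq)
      exact mem_coe.2 (mem_image_of_mem f ha)
    · intro q hq r hr hqr
      obtain ⟨a, ha, rfl⟩ := mem_image.1 (mem_coe.1 hq)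
      obtain ⟨b, hb, rfl⟩ := mem_image.1 (mem_coe.1 hr)
      exact Prod.ext hqr (h a ha b hb hqr)
  have h2 : P.image Prod.snd = F.image g := by
    rw [hP, image_image]
    rfl
  have h3 : Set.InjOn Prod.snd (P : Set (β × γ)) := by
    rw [← card_image_iff, h2]
    refine le_antisymm ?_ (h1.trans hcard)
    rw [← h2]
    exact card_image_le
  exact congrArg Prod.fst (h3 (mem_coe.2 (mem_image_of_mem _ ha))
    (mem_coe.2 (mem_image_of_mem _ hb)) hab)

theorem fib_pos (hx : x ∈ A) : 0 < fib A x :=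
  card_pos.2 ⟨x, mem_filter.2 ⟨hx, by simp⟩⟩

theorem lin_pos (hx : x ∈ A) : 0 < lin A s x :=
  card_pos.2 ⟨x, mem_filter.2 ⟨hx, by simp [symp_zero_left]⟩⟩

theorem fib_le_lin : fib A x ≤ lin A s x := by
  refine card_le_card fun a ha => ?_
  rw [mem_filter] at ha ⊢
  exact ⟨ha.1, by rw [← symp_smul_left, ha.2, symp_zero_left]⟩

theorem hco_le_cos : hco A s x ≤ cos A s x := by
  refine card_le_card fun a ha => ?_
  rw [mem_filter] at ha ⊢
  exact ⟨ha.1, ha.2.2⟩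

theorem exists_ne_of_one_lt_fib (h : 1 < fib A x) : ∃ a ∈ A, ∃ b ∈ A,
    a ≠ b ∧ (p : ZMod (p ^ 2)) • (a - b) = 0 ∧ (p : ZMod (p ^ 2)) • (a - x) = 0 := by
  obtain ⟨a, ha, b, hb, hab⟩ := one_lt_card.1 h
  rw [mem_filter] at ha hb
  refine ⟨a, ha.1, b, hb.1, hab, ?_, ha.2⟩
  rw [← sub_sub_sub_cancel_right a b x, smul_sub, ha.2, hb.2, sub_zero]

theorem exists_of_fib_pos (h : 0 < fib A x) : ∃ a ∈ A, (p : ZMod (p ^ 2)) • (a - x) = 0 := by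
  obtain ⟨a, ha⟩ := card_pos.1 h
  exact ⟨a, (mem_filter.1 ha).1, (mem_filter.1 ha).2⟩

theorem fib_le_one (h : ∀ a ∈ A, ∀ b ∈ A, (p : ZMod (p ^ 2)) • (a - b) = 0 → a = b) :
    fib A x ≤ 1 := by
  by_contra! h1
  obtain ⟨a, ha, b, hb, hab, h2, -⟩ := exists_ne_of_one_lt_fib h1
  exact hab (h a ha b hb h2)

theorem two_le_card_filter {q : Plane p → Prop} [DecidablePred q] {a b : Plane p} (ha : a ∈ A)
    (hb : b ∈ A) (hab : a ≠ b) (hqa : q a) (hqb : q b) : 2 ≤ (A.filter q).card :=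
  one_lt_card.2 ⟨a, mem_filter.2 ⟨ha, hqa⟩, b, mem_filter.2 ⟨hb, hqb⟩, hab⟩

theorem two_le_cos {a b : Plane p} (ha : a ∈ A) (hb : b ∈ A) (hab : a ≠ b)
    (h : symp (a - b) s = 0) : 2 ≤ cos A s b :=
  two_le_card_filter ha hb hab h (by rw [sub_self, symp_zero_left])

theorem hco_le (hs : (p : ZMod (p ^ 2)) • s ≠ 0) : hco A s x ≤ p := by
  obtain ⟨t, ht⟩ := exists_symp_eq_one hs
  conv_rhs => rw [← card_pMultiples (p := p)]
  refine card_le_card_of_injOn (fun a => symp (a - x) t) ?_ ?_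
  · intro a ha
    rw [mem_coe, mem_filter] at ha
    rw [mem_coe, mem_pMultiples, ← symp_smul_left, ha.2.1, symp_zero_left]
  · intro a ha b hb hab
    rw [mem_coe, mem_filter] at ha hb
    rw [← sub_eq_zero, ← sub_sub_sub_cancel_right a b x, eq_zero_iff_symp ht, symp_sub_left,
      symp_sub_left _ _ t, ha.2.2, hb.2.2, sub_self]
    exact ⟨rfl, sub_eq_zero.2 hab⟩

theorem fib_le (h : ∀ a ∈ A, ∀ b ∈ A, (p : ZMod (p ^ 2)) • (a - b) = 0 →
    symp (a - b) s = 0 → a = b) : fib A x ≤ p := by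
  conv_rhs => rw [← card_pMultiples (p := p)]
  refine card_le_card_of_injOn (fun a => symp (a - x) s) ?_ ?_
  · intro a ha
    rw [mem_coe, mem_filter] at ha
    rw [mem_coe, mem_pMultiples, ← symp_smul_left, ha.2, symp_zero_left]
  · intro a ha b hb hab
    rw [mem_coe, mem_filter] at ha hb
    refine h a ha.1 b hb.1 ?_ ?_
    · rw [← sub_sub_sub_cancel_right a b x, smul_sub, ha.2, hb.2, sub_self]
    · rw [← sub_sub_sub_cancel_right a b x, symp_sub_left, sub_eq_zero]
      exact hab

/-- The fibre of `b` inside a line, in terms of coordinates. -/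
theorem fib_eq_card_filter_lin (h : symp s t = 1) {b : Plane p}
    (hb : (p : ZMod (p ^ 2)) * symp (b - x) s = 0) :
    fib A b = ((A.filter fun a => (p : ZMod (p ^ 2)) * symp (a - x) s = 0).filter fun a =>
      (p : ZMod (p ^ 2)) * symp a t = p * symp b t).card := by
  rw [fib, filter_filter]
  congr 1
  refine filter_congr fun a _ => ?_
  rw [p_smul_eq_zero_iff h, symp_sub_left, symp_sub_left, symp_sub_left]
  rw [symp_sub_left] at hb
  constructor
  · rintro ⟨h1, h2⟩
    exact ⟨by linear_combination h1 + hb, by linear_combination h2⟩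
  · rintro ⟨h1, h2⟩
    exact ⟨by linear_combination h1 - hb, by linear_combination h2⟩

theorem lin_congr_point {y : Plane p} (h : (p : ZMod (p ^ 2)) * symp (x - y) s = 0) :
    lin A s x = lin A s y := by
  rw [lin, lin]
  congr 1
  refine filter_congr fun a _ => ?_
  rw [symp_sub_left] at *
  constructor
  · intro h1; rw [symp_sub_left]; linear_combination h1 + h
  · intro h1; rw [symp_sub_left] at h1; linear_combination h1 - h

theorem lin_le_mul (hs : (p : ZMod (p ^ 2)) • s ≠ 0) {k : ℕ} (hk : ∀ a ∈ A, fib A a ≤ k) :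
    lin A s x ≤ p * k := by
  obtain ⟨t, ht⟩ := exists_symp_eq_one hs
  conv_rhs => rw [mul_comm, ← card_pMultiples (p := p)]
  refine card_le_mul_card_image_of_maps_to (f := fun a => (p : ZMod (p ^ 2)) * symp a t)
    (fun a _ => p_mul_mem_pMultiples _) k ?_
  intro c _
  rcases eq_empty_or_nonempty ((A.filter fun a => (p : ZMod (p ^ 2)) * symp (a - x) s = 0).filter
    fun a => (p : ZMod (p ^ 2)) * symp a t = c) with h | ⟨b, hb⟩
  · rw [h]; simp
  · rw [mem_filter, mem_filter] at hb
    rw [← hb.2, ← fib_eq_card_filter_lin ht hb.1.2]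
    exact hk b hb.1.1

theorem dvd_lin (hs : (p : ZMod (p ^ 2)) • s ≠ 0) {d : ℕ} (hd : ∀ a ∈ A, d ∣ fib A a) :
    d ∣ lin A s x := by
  obtain ⟨t, ht⟩ := exists_symp_eq_one hs
  rw [lin, card_eq_sum_card_image (fun a => (p : ZMod (p ^ 2)) * symp a t)]
  refine dvd_sum fun c hc => ?_
  obtain ⟨b, hb, rfl⟩ := mem_image.1 hc
  rw [mem_filter] at hb
  rw [← fib_eq_card_filter_lin ht hb.2]
  exact hd b hb.1

theorem lin_eq_card_filter {b : Plane p} : lin A s b = (A.filter fun a =>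
      (p : ZMod (p ^ 2)) * symp a s = p * symp b s).card := by
  simp only [lin, symp_sub_left, mul_sub, sub_eq_zero]

theorem cos_eq_card_filter {b : Plane p} : cos A s b = (A.filter fun a =>
      symp a s = symp b s).card := by
  simp only [cos, symp_sub_left, sub_eq_zero]

theorem card_le_mul_lin {k : ℕ} (hk : ∀ a ∈ A, lin A s a ≤ k) : A.card ≤ p * k := by
  conv_rhs => rw [mul_comm, ← card_pMultiples (p := p)]
  refine card_le_mul_card_image_of_maps_to (f := fun a => (p : ZMod (p ^ 2)) * symp a s)
    (fun a _ => p_mul_mem_pMultiples _) k ?_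
  intro c _
  rcases eq_empty_or_nonempty (A.filter fun a => (p : ZMod (p ^ 2)) * symp a s = c)
    with h | ⟨b, hb⟩
  · rw [h]; simp
  · rw [mem_filter] at hb
    rw [← hb.2, ← lin_eq_card_filter]
    exact hk b hb.1

theorem dvd_card {d : ℕ} (hd : ∀ a ∈ A, d ∣ lin A s a) : d ∣ A.card := by
  rw [card_eq_sum_card_image (fun a => (p : ZMod (p ^ 2)) * symp a s)]
  refine dvd_sum fun c hc => ?_
  obtain ⟨b, hb, rfl⟩ := mem_image.1 hc
  rw [← lin_eq_card_filter]
  exact hd b hb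

theorem card_le_mul_cos {k : ℕ} (hk : ∀ a ∈ A, cos A s a ≤ k) : A.card ≤ p ^ 2 * k := by
  have hc : (univ : Finset (ZMod (p ^ 2))).card = p ^ 2 := by rw [card_univ, ZMod.card]
  rw [mul_comm, ← hc]
  refine card_le_mul_card_image_of_maps_to (f := fun a => symp a s)
    (fun a _ => mem_univ _) k ?_
  intro c _
  rcases eq_empty_or_nonempty (A.filter fun a => symp a s = c)
    with h | ⟨b, hb⟩
  · rw [h]; simp
  · rw [mem_filter] at hb
    rw [← hb.2, ← cos_eq_card_filter]
    exact hk b hb.1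

theorem Van.p_dvd_card (h : Van A s) : p ∣ A.card :=
  dvd_card fun a _ => ⟨_, (h.p_mul_cos a).symm⟩

theorem exists_ne_cos (h : p ^ 2 < A.card) (s : Plane p) :
    ∃ a ∈ A, ∃ b ∈ A, a ≠ b ∧ symp (a - b) s = 0 := by
  have hc : (univ : Finset (ZMod (p ^ 2))).card = p ^ 2 := by rw [card_univ, ZMod.card]
  rw [← hc] at h
  obtain ⟨a, ha, b, hb, hab, e⟩ := exists_ne_map_eq_of_card_lt_of_maps_to h
    (f := fun a => symp a s) (fun a _ => mem_univ _)
  exact ⟨a, ha, b, hb, hab, by rw [symp_sub_left, sub_eq_zero]; exact e⟩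

theorem exists_ne_lin (h : p < A.card) (s : Plane p) :
    ∃ a ∈ A, ∃ b ∈ A, a ≠ b ∧ (p : ZMod (p ^ 2)) * symp (a - b) s = 0 := by
  conv_lhs at h => rw [← card_pMultiples (p := p)]
  obtain ⟨a, ha, b, hb, hab, e⟩ := exists_ne_map_eq_of_card_lt_of_maps_to h
    (f := fun a => (p : ZMod (p ^ 2)) * symp a s) (fun a _ => p_mul_mem_pMultiples _)
  exact ⟨a, ha, b, hb, hab, by rw [symp_sub_left, mul_sub, sub_eq_zero]; exact e⟩

theorem exists_ne_fib (h : p ^ 2 < A.card) :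
    ∃ a ∈ A, ∃ b ∈ A, a ≠ b ∧ (p : ZMod (p ^ 2)) • (a - b) = 0 := by
  have hc : ((pMultiples p) ×ˢ (pMultiples p)).card = p ^ 2 := by
    rw [card_product, card_pMultiples, pow_two]
  rw [← hc] at h
  obtain ⟨a, ha, b, hb, hab, e⟩ := exists_ne_map_eq_of_card_lt_of_maps_to h
    (f := fun a => (p : ZMod (p ^ 2)) • a)
    (fun a _ => mem_coe.2 (mem_product.2 ⟨p_mul_mem_pMultiples _, p_mul_mem_pMultiples _⟩))
  exact ⟨a, ha, b, hb, hab, by rw [smul_sub, sub_eq_zero]; exact e⟩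

/-- If `A` vanishes at `s` and points of `A` in a common coset of `⟨s⟩` are congruent mod `p`, then
each fibre is a union of parts of `lin A s x / p` points. -/
theorem Van.lin_dvd (h : Van A s)
    (hm : ∀ a ∈ A, ∀ b ∈ A, symp (a - b) s = 0 → (p : ZMod (p ^ 2)) • (a - b) = 0)
    (x : Plane p) : lin A s x ∣ p * fib A x := by
  rw [← h.p_mul_cos]
  refine mul_dvd_mul_left p ?_
  rw [fib, card_eq_sum_card_image (fun a => symp (a - x) s)]
  refine dvd_sum fun c hc => ?_
  obtain ⟨b, hb, rfl⟩ := mem_image.1 hc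
  rw [mem_filter] at hb
  have e : ((A.filter fun a => (p : ZMod (p ^ 2)) • (a - x) = 0).filter
      fun a => symp (a - x) s = symp (b - x) s) = A.filter fun a => symp (a - b) s = 0 := by
    rw [filter_filter]
    refine filter_congr fun a ha => ?_
    rw [← sub_sub_sub_cancel_right a b x, symp_sub_left (a - x), sub_eq_zero,
      and_iff_right_iff_imp]
    intro h1
    have h2 := hm a ha b hb.1 (by
      rw [← sub_sub_sub_cancel_right a b x, symp_sub_left (a - x), sub_eq_zero, h1])
    have e2 : a - x = (a - b) + (b - x) := by abel
    rw [e2, smul_add, h2, hb.2, add_zero]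
  rw [e]
  have e3 : cos A s x = cos A s b := by
    refine Nat.eq_of_mul_eq_mul_left hp.out.pos ?_
    rw [h.p_mul_cos, h.p_mul_cos]
    refine (lin_congr_point ?_).symm
    rw [← symp_smul_left, hb.2, symp_zero_left]
  rw [e3, cos]

end Bounds

/-! ### Sets of combinations of two vectors, used as complements and spectra -/

section Combinations

variable {p : ℕ} [hp : Fact p.Prime] {s t : Plane p} {X Y : Finset (ZMod (p ^ 2))}

/-- All combinations `x • s + y • t` with `x ∈ X` and `y ∈ Y`. -/
def combos (X Y : Finset (ZMod (p ^ 2))) (s t : Plane p) : Finset (Plane p) :=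
  (X ×ˢ Y).image fun q => q.1 • s + q.2 • t

theorem card_combos (h : (p : ZMod (p ^ 2)) * symp s t ≠ 0) :
    (combos X Y s t).card = X.card * Y.card := by
  rw [combos, card_image_of_injective, card_product]
  rintro ⟨x, y⟩ ⟨x', y'⟩ e
  have hu := ZMod.isUnit_of_p_mul_ne_zero h
  simp only at e
  have h1 := congrArg (fun z => symp z t) e
  have h2 := congrArg (fun z => symp s z) e
  simp only [symp_add_left, symp_smul_left, symp_self, mul_zero, add_zero, zero_add,
    symp_add_right, symp_smul_right] at h1 h2
  rw [hu.mul_right_cancel h1, hu.mul_right_cancel h2]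

theorem exists_of_mem_combos {b b' : Plane p} (hb : b ∈ combos X Y s t)
    (hb' : b' ∈ combos X Y s t) : ∃ x ∈ X, ∃ x' ∈ X, ∃ y ∈ Y, ∃ y' ∈ Y,
      b - b' = (x - x') • s + (y - y') • t := by
  obtain ⟨⟨x, y⟩, hxy, rfl⟩ := mem_image.1 hb
  obtain ⟨⟨x', y'⟩, hxy', rfl⟩ := mem_image.1 hb'
  rw [mem_product] at hxy hxy'
  refine ⟨x, hxy.1, x', hxy'.1, y, hxy.2, y', hxy'.2, ?_⟩
  simp only
  module

theorem digit_sub {k l : ZMod (p ^ 2)} (hk : k ∈ digits p) (hl : l ∈ digits p) :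
    k = l ∨ IsUnit (k - l) := by
  by_cases h : (p : ZMod (p ^ 2)) * (k - l) = 0
  · exact Or.inl (digit_unique hk hl (by rwa [mul_sub, sub_eq_zero] at h))
  · exact Or.inr (ZMod.isUnit_of_p_mul_ne_zero h)

theorem pMultiple_sub {k l : ZMod (p ^ 2)} (hk : k ∈ pMultiples p) (hl : l ∈ pMultiples p) :
    (p : ZMod (p ^ 2)) * (k - l) = 0 := by
  rw [mul_sub, mem_pMultiples.1 hk, mem_pMultiples.1 hl, sub_zero]

theorem card_univ_sq : (univ : Finset (ZMod (p ^ 2))).card = p ^ 2 := by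
  rw [card_univ, ZMod.card]

end Combinations

/-! ### Spectral sets: missing zeros, and the sizes from `p³` upwards -/

section SpectralToTile

variable {p : ℕ} [hp : Fact p.Prime] {A S : Finset (Plane p)} {s t x : Plane p}

theorem isTile_of_combos {X Y : Finset (ZMod (p ^ 2))} (hst : (p : ZMod (p ^ 2)) * symp s t ≠ 0)
    (hcard : A.card * (X.card * Y.card) = p ^ 4)
    (h : ∀ a ∈ A, ∀ a' ∈ A, ∀ x ∈ X, ∀ x' ∈ X, ∀ y ∈ Y, ∀ y' ∈ Y,
      a - a' = (x - x') • s + (y - y') • t → a = a') : IsTile A := by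
  refine isTile_of_card_mul (B := combos X Y s t) (by rw [card_combos hst, hcard]) ?_
  intro a ha a' ha' b hb b' hb' e
  obtain ⟨x, hx, x', hx', y, hy, y', hy', e'⟩ := exists_of_mem_combos hb hb'
  exact h a ha a' ha' x hx x' hx' y hy y' hy' (e.trans e')

/-- A primitive difference lying in ⟨s⟩ would be a unit multiple of `s`, and so a zero. -/
theorem Orth.p_smul_eq_zero (h : Orth A S) (hs : (p : ZMod (p ^ 2)) • s ≠ 0) (hv : ¬ Van A s) :
    ∀ a ∈ S, ∀ b ∈ S, symp (a - b) s = 0 → (p : ZMod (p ^ 2)) • (a - b) = 0 := by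
  intro a ha b hb hab
  by_contra h0
  have hne : a ≠ b := by
    rintro rfl
    exact h0 (by rw [sub_self, smul_zero])
  exact hv ((van_iff_of_symp_eq_zero hs h0 hab).1 (h a ha b hb hne))

/-- A nonzero such difference is `p • z` with `z` parallel to `s` mod p, hence a unit multiple of `p
• s`. -/
theorem Orth.eq_of_hco (h : Orth A S) (hs : (p : ZMod (p ^ 2)) • s ≠ 0)
    (hv : ¬ Van A ((p : ZMod (p ^ 2)) • s)) :
    ∀ a ∈ S, ∀ b ∈ S, (p : ZMod (p ^ 2)) • (a - b) = 0 → symp (a - b) s = 0 → a = b := by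
  intro a ha b hb hab hab'
  by_contra hne
  obtain ⟨z, hz⟩ := exists_eq_p_smul hab
  have hz0 : (p : ZMod (p ^ 2)) • z ≠ 0 := by
    rw [← hz]
    exact sub_ne_zero.2 hne
  have hvz := h a ha b hb hne
  rw [hz] at hvz hab'
  rw [symp_smul_left] at hab'
  exact hv ((van_p_smul_iff hs hz0 hab').1 hvz)

theorem Orth.p_smul_eq_zero_of_lin (h : Orth A S)
    (hv : ∀ s' : Plane p, (p : ZMod (p ^ 2)) • s' ≠ 0 → (p : ZMod (p ^ 2)) * symp s' s = 0 →
      ¬ Van A s') :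
    ∀ a ∈ S, ∀ b ∈ S, (p : ZMod (p ^ 2)) * symp (a - b) s = 0 →
      (p : ZMod (p ^ 2)) • (a - b) = 0 := by
  intro a ha b hb hab
  by_contra h0
  have hne : a ≠ b := by
    rintro rfl
    exact h0 (by rw [sub_self, smul_zero])
  exact hv _ h0 hab (h a ha b hb hne)

/-- With more than `p²` points, `S` has two in one coset of ⟨s⟩. Their difference is a unit multiple
of `s` or of `p • s`. -/
theorem Orth.van_or_van (h : Orth A S) (hS : p ^ 2 < S.card) (hs : (p : ZMod (p ^ 2)) • s ≠ 0) :
    Van A s ∨ Van A ((p : ZMod (p ^ 2)) • s) := by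
  by_contra! hv
  obtain ⟨a, ha, b, hb, hab, e⟩ := exists_ne_cos hS s
  exact hab (h.eq_of_hco hs hv.2 a ha b hb (h.p_smul_eq_zero hs hv.1 a ha b hb e) e)

theorem Orth.fib_eq (h : Orth A S) (hS : p ^ 2 < S.card) (hs : (p : ZMod (p ^ 2)) • s ≠ 0)
    (hv : ¬ Van A ((p : ZMod (p ^ 2)) • s)) (x : Plane p) : fib A x = p * hco A s x := by
  refine fib_eq_p_mul_hco hs (fun s' hs' e => (h.van_or_van hS hs').resolve_right ?_) x
  rwa [van_p_smul_iff hs hs' e]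

theorem Orth.exists_p_smul (h : Orth A S)
    (hS : ¬ ∀ a ∈ S, ∀ b ∈ S, (p : ZMod (p ^ 2)) • (a - b) = 0 → a = b) :
    ∃ a ∈ S, ∃ b ∈ S, a ≠ b ∧ ∃ z, (p : ZMod (p ^ 2)) • z ≠ 0 ∧
      a - b = (p : ZMod (p ^ 2)) • z ∧ Van A ((p : ZMod (p ^ 2)) • z) := by
  push Not at hS
  obtain ⟨a, ha, b, hb, hab, hne⟩ := hS
  obtain ⟨z, hz⟩ := exists_eq_p_smul hab
  refine ⟨a, ha, b, hb, hne, z, ?_, hz, ?_⟩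
  · rw [← hz]
    exact sub_ne_zero.2 hne
  · rw [← hz]
    exact h a ha b hb hne

theorem cos_le_of_p_smul (hs : (p : ZMod (p ^ 2)) • s ≠ 0)
    (hm : ∀ a ∈ A, ∀ b ∈ A, symp (a - b) s = 0 → (p : ZMod (p ^ 2)) • (a - b) = 0)
    (hx : x ∈ A) : cos A s x ≤ p := by
  refine le_trans (card_le_card fun a ha => ?_) (hco_le (A := A) (x := x) hs)
  rw [mem_filter] at ha ⊢
  exact ⟨ha.1, hm a ha.1 x hx ha.2, ha.2⟩

theorem Orth.van_of_card (h : Orth A S) (hS : p ^ 3 < S.card) (hs : (p : ZMod (p ^ 2)) • s ≠ 0) :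
    Van A s := by
  by_contra hv
  have := card_le_mul_cos (A := S) (s := s) (k := p)
    fun a ha => cos_le_of_p_smul hs (h.p_smul_eq_zero hs hv) ha
  have e : p ^ 2 * p = p ^ 3 := by ring
  omega

theorem isTile_of_card_one (hA : A.card = 1) : IsTile A := by
  refine isTile_of_card_mul (B := univ) (by rw [hA, one_mul, card_univ, card_plane]) ?_
  intro a ha a' ha' _ _ _ _ _
  exact card_le_one.1 hA.le a ha a' ha'

theorem isTile_of_card_eq (hA : A.card = p ^ 4) : IsTile A := by
  refine isTile_of_card_mul (B := {0}) (by rw [hA, card_singleton, mul_one]) ?_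
  intro a _ a' _ b hb b' hb' e
  rw [mem_singleton] at hb hb'
  rw [hb, hb', sub_self] at e
  exact sub_eq_zero.1 e

/-- Both sets vanish at all primitive frequencies, so both are unions of cosets of `p • G`. Then `S`
has every `p • s` as a difference, which makes `A` vanish off 0 and forces `#A = p ^ 4`. -/
theorem Orth.isTile_of_lt (h : Orth A S) (h' : Orth S A) (hc : S.card = A.card)
    (hA : p ^ 3 < A.card) : IsTile A := by
  have h1 := fib_eq_of_van_prim fun s hs => h.van_of_card (s := s) (by rwa [hc]) hs
  have h2 := fun s hs => h'.van_of_card (s := s) hA hs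
  obtain ⟨b, hb⟩ : S.Nonempty := card_pos.1 (by omega)
  obtain ⟨a, ha⟩ : A.Nonempty := card_pos.1 (by omega)
  have h3 := card_eq_p_sq_mul_fib (A := A) (fun s hs => by
    have h4 := add_mem_of_van_prim h2 hb (p_smul_p_smul s)
    have h5 := h _ h4 b hb (by simpa using hs)
    rwa [add_sub_cancel_left] at h5) a
  rw [h1, if_pos ha] at h3
  exact isTile_of_card_eq (by rw [h3]; ring)

/-- If `S` is a union of cosets of `p • G`, its differences give `A` exactly one point in each coset
of some ⟨p • (a - b)⟩, which is the complement. If `S` has a primitive non-zero `s` of its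
transform, no two points of `A` differ by a unit multiple of `s`, and the digit multiples of `s`
form a complement. -/
theorem Orth.isTile_of_card_eq_cube (h : Orth A S) (h' : Orth S A) (hc : S.card = A.card)
    (hA : A.card = p ^ 3) : IsTile A := by
  have hp2 := hp.out.two_le
  by_cases hv : ∀ s : Plane p, (p : ZMod (p ^ 2)) • s ≠ 0 → Van S s
  · obtain ⟨a, ha, b, hb, hab⟩ : ∃ a ∈ S, ∃ b ∈ S, (p : ZMod (p ^ 2)) • (a - b) ≠ 0 := by
      by_contra! h0
      obtain ⟨b, hb⟩ : S.Nonempty := card_pos.1 (by rw [hc, hA]; positivity)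
      have h1 : S.card ≤ fib S b := card_le_card fun a ha => mem_filter.2 ⟨ha, h0 a ha b hb⟩
      rw [fib_eq_of_van_prim hv, if_pos hb, hc, hA] at h1
      have : p ^ 3 = p ^ 2 * p := by ring
      have : 0 < p ^ 2 := by positivity
      nlinarith
    have h1 : ∀ x, fib A x = p := fun x => by
      have h3 := card_eq_p_sq_mul_fib (A := A) (fun s hs => by
        have h4 := add_mem_of_van_prim hv hb (p_smul_p_smul s)
        have h5 := h _ h4 b hb (by simpa using hs)
        rwa [add_sub_cancel_left] at h5) x
      rw [hA, pow_succ] at h3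
      exact (Nat.eq_of_mul_eq_mul_left (by positivity) h3).symm
    have h2 : ∀ x, fib A x = p * hco A (a - b) x := by
      refine fun x => fib_eq_p_mul_hco hab (fun s' hs' e => ?_) x
      obtain ⟨k, hk, e'⟩ := exists_unit_p_smul hs' hab
        (by rw [symp_swap, mul_neg, e, neg_zero])
      -- Moving `a` within its fibre keeps it in `S` and makes the difference from `b` exactly `k •
      -- s'`.
      have h4 := add_mem_of_van_prim hv ha (y := k • s' - (a - b))
        (by rw [smul_sub, e', sub_self])
      have h6 : a + (k • s' - (a - b)) - b = k • s' := by abel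
      have h7 : a + (k • s' - (a - b)) ≠ b := by
        intro h8
        rw [h8, sub_self] at h6
        exact p_smul_ne_zero_of_isUnit hk hs' (by rw [← h6, smul_zero])
      have h5 := h _ h4 b hb h7
      rw [h6] at h5
      exact (van_smul_iff hk).1 h5
    obtain ⟨t, ht⟩ := exists_symp_eq_one hab
    refine isTile_of_combos (s := a - b) (t := t) (X := pMultiples p) (Y := {0}) ?_ ?_ ?_
    · rw [ht, mul_one]; exact ZMod.sq_cast_ne_zero
    · rw [hA, card_pMultiples, card_singleton]; ring
    · intro c hc d hd x hx x' hx' y hy y' hy' e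
      rw [mem_singleton] at hy hy'
      rw [hy, hy', sub_self, zero_smul, add_zero] at e
      by_contra hne
      have h3 : 2 ≤ hco A (a - b) d := by
        refine two_le_card_filter hc hd hne ?_ ?_
        · rw [e, smul_smul, pMultiple_sub hx hx', zero_smul, symp_smul_left, symp_self, mul_zero]
          exact ⟨rfl, rfl⟩
        · simp [symp_zero_left]
      have h4 := h2 d
      rw [h1] at h4
      nlinarith
  · push Not at hv
    obtain ⟨s, hs, hv⟩ := hv
    have hm := h'.p_smul_eq_zero hs hv
    obtain ⟨t, ht⟩ := exists_symp_eq_one hs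
    refine isTile_of_combos (s := s) (t := t) (X := digits p) (Y := {0}) ?_ ?_ ?_
    · rw [ht, mul_one]; exact ZMod.sq_cast_ne_zero
    · rw [hA, card_digits, card_singleton]; ring
    · intro c hc d hd x hx x' hx' y hy y' hy' e
      rw [mem_singleton] at hy hy'
      rw [hy, hy', sub_self, zero_smul, add_zero] at e
      rcases digit_sub hx hx' with h0 | h0
      · rw [h0, sub_self, zero_smul] at e
        exact sub_eq_zero.1 e
      · exfalso
        have h1 := hm c hc d hd (by rw [e, symp_smul_left, symp_self, mul_zero])
        rw [e] at h1
        exact p_smul_ne_zero_of_isUnit h0 hs h1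

/-- Otherwise the nonempty fibres of `A` have `p²` points. Two congruent points of `S` give a zero
`p • z`, so `A` is `p` times a line count divisible by `p²`, and `p³ ∣ #A`. -/
theorem Orth.exists_not_van (h : Orth A S) (hc : S.card = A.card) (h2 : p ^ 2 < A.card)
    (h3 : A.card < p ^ 3) : ∃ s : Plane p, (p : ZMod (p ^ 2)) • s ≠ 0 ∧ ¬ Van A s ∧
      Van A ((p : ZMod (p ^ 2)) • s) := by
  suffices hs : ∃ s : Plane p, (p : ZMod (p ^ 2)) • s ≠ 0 ∧ ¬ Van A s by
    obtain ⟨s, hs, hv⟩ := hs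
    exact ⟨s, hs, hv, (h.van_or_van (by rwa [hc]) hs).resolve_left hv⟩
  by_contra! hv
  obtain ⟨a, -, b, -, -, z, hz, -, hvz⟩ := h.exists_p_smul (by
    push Not
    obtain ⟨a, ha, b, hb, hab, e⟩ := exists_ne_fib (A := S) (by rwa [hc])
    exact ⟨a, ha, b, hb, e, hab⟩)
  have h4 := hvz.p_mul_lin 0
  obtain ⟨k, hk⟩ := dvd_lin (x := 0) hz (d := p ^ 2) fun a (ha : a ∈ A) =>
    ⟨1, by rw [fib_eq_of_van_prim hv, if_pos ha]⟩
  rw [hk] at h4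
  have h5 : A.card = p ^ 3 * k := by rw [← h4]; ring
  rcases Nat.eq_zero_or_pos k with rfl | hk0
  · omega
  · nlinarith

theorem card_image_symp_le (x : Plane p) :
    ((A.filter fun a => (p : ZMod (p ^ 2)) * symp (a - x) s = 0).image
      fun a => symp a s).card ≤ p := by
  have e : ((pMultiples p).image fun c => symp x s + c).card ≤ p :=
    card_image_le.trans card_pMultiples.le
  refine le_trans (card_le_card ?_) e
  intro c hc
  obtain ⟨a, ha, rfl⟩ := mem_image.1 hc
  refine mem_image.2 ⟨symp (a - x) s, mem_pMultiples.2 (mem_filter.1 ha).2, ?_⟩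
  rw [symp_sub_left, add_sub_cancel]

theorem exists_not_fib (h : fib A x < lin A s x) : ∃ a ∈ A,
    (p : ZMod (p ^ 2)) * symp (a - x) s = 0 ∧ (p : ZMod (p ^ 2)) • (a - x) ≠ 0 := by
  obtain ⟨a, ha, ha'⟩ := exists_mem_notMem_of_card_lt_card h
  rw [mem_filter] at ha ha'
  exact ⟨a, ha.1, ha.2, fun h0 => ha' ⟨ha.1, h0⟩⟩

end SpectralToTile

/-! ### No spectral set has size strictly between `p²` and `p³` -/

section IntermediateSizes

variable {p : ℕ} [hp : Fact p.Prime] {A S : Finset (Plane p)} {s t x : Plane p}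

/-- On one line mod p the coset of ⟨s⟩ determines the fibre. There are at most `p` cosets and all
`p` fibres occur, so conversely the fibre determines the coset. -/
theorem p_smul_of_image_lin (hs : (p : ZMod (p ^ 2)) • s ≠ 0) (hf : ∀ y, 0 < fib S y)
    (hm : ∀ a ∈ S, ∀ b ∈ S, symp (a - b) s = 0 → (p : ZMod (p ^ 2)) • (a - b) = 0) :
    ∀ a ∈ S, ∀ b ∈ S, (p : ZMod (p ^ 2)) • (a - b) = 0 → symp (a - b) s = 0 := by
  intro a ha b hb hab
  obtain ⟨t, ht⟩ := exists_symp_eq_one hs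
  have hab' := (p_smul_eq_zero_iff ht _).1 hab
  rw [symp_sub_left, sub_eq_zero]
  refine eq_of_refines (F := S.filter fun a => (p : ZMod (p ^ 2)) * symp (a - b) s = 0)
    (f := fun a => symp a s) (g := fun a => (p : ZMod (p ^ 2)) * symp a t) ?_ ?_
    (mem_filter.2 ⟨ha, hab'.1⟩) (mem_filter.2 ⟨hb, by simp [symp_zero_left]⟩) ?_
  · intro c hc d hd hcd
    have h1 := hm c (mem_filter.1 hc).1 d (mem_filter.1 hd).1
      (by rw [symp_sub_left, sub_eq_zero]; exact hcd)
    have h2 := ((p_smul_eq_zero_iff ht _).1 h1).2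
    rwa [symp_sub_left, mul_sub, sub_eq_zero] at h2
  · refine (card_image_symp_le b).trans ?_
    conv_lhs => rw [← card_pMultiples (p := p)]
    refine card_le_card fun c hc => ?_
    obtain ⟨d, rfl⟩ := ZMod.exists_of_p_mul_eq_zero (mem_pMultiples.1 hc)
    obtain ⟨e, he, hey⟩ := exists_of_fib_pos (hf (b + (d - symp b t) • s))
    have hey' := (p_smul_eq_zero_iff ht _).1 hey
    simp only [symp_sub_left, symp_add_left, symp_smul_left, symp_self, ht] at hey'
    refine mem_image.2 ⟨e, mem_filter.2 ⟨he, ?_⟩, ?_⟩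
    · rw [symp_sub_left]
      linear_combination hey'.1
    · linear_combination hey'.2
  · have h2 := hab'.2
    rwa [symp_sub_left, mul_sub, sub_eq_zero] at h2

/-- All fibres of `S` have the same size, strictly between 1 and `p`. Two points of one fibre
determine a direction mod p, to which every primitive non-zero of the transform of `A` must be
parallel. Hence `A` is a union of cosets of ⟨p • s⟩, and the zero `c - b` parallel to `s` inflates
`#A` to at least `p³`. -/
theorem Orth.not_full_of_lt (h : Orth A S) (hc : S.card = A.card) (h2 : p ^ 2 < A.card)
    (h3 : A.card < p ^ 3)
    (hfull : ∀ s : Plane p, (p : ZMod (p ^ 2)) • s ≠ 0 → Van S ((p : ZMod (p ^ 2)) • s)) :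
    False := by
  obtain ⟨s, hs, hv, hvp⟩ := h.exists_not_van hc h2 h3
  have hfib := card_eq_p_sq_mul_fib hfull
  have hp2 : 0 < p ^ 2 := pow_pos hp.out.pos 2
  have h1m : ∀ x, 1 < fib S x := fun x => by
    have := hfib x
    by_contra! h0
    have : p ^ 2 * fib S x ≤ p ^ 2 * 1 := Nat.mul_le_mul_left _ h0
    omega
  have hmp : ∀ x, fib S x < p := fun x => by
    have := hfib x
    by_contra! h0
    have : p ^ 2 * p ≤ p ^ 2 * fib S x := Nat.mul_le_mul_left _ h0
    have e : p ^ 3 = p ^ 2 * p := by ring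
    omega
  have hcol : ∀ s' : Plane p, (p : ZMod (p ^ 2)) • s' ≠ 0 → ¬ Van A s' → ∀ a ∈ S, ∀ b ∈ S,
      (p : ZMod (p ^ 2)) • (a - b) = 0 → symp (a - b) s' = 0 := fun s' hs' hv' =>
    p_smul_of_image_lin hs' (fun y => (h1m y).le) (h.p_smul_eq_zero hs' hv')
  have hh := hco_eq_of_van_off (A := A) hs (by
    intro s' hs's
    by_contra hv'
    have hs' := prim_of_p_mul_symp_ne_zero hs's
    obtain ⟨a, ha, b, hb, hab, hab', -⟩ := exists_ne_of_one_lt_fib (h1m 0)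
    have h4 := hcol s hs hv a ha b hb hab'
    have h5 := hcol s' hs' hv' a ha b hb hab'
    obtain ⟨z, hz⟩ := exists_eq_p_smul hab'
    have hz0 : (p : ZMod (p ^ 2)) • z ≠ 0 := by
      rw [← hz]
      exact sub_ne_zero.2 hab
    rw [hz, symp_smul_left] at h4 h5
    apply hs's
    rw [p_mul_symp_iff hz0 hs (by rw [symp_swap, mul_neg, h4, neg_zero])]
    rw [symp_swap, mul_neg, h5, neg_zero])
  obtain ⟨a, ha⟩ : A.Nonempty := card_pos.1 (by omega)
  obtain ⟨b, hb, -⟩ := exists_of_fib_pos ((h1m 0).le)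
  obtain ⟨c, hc', hcs⟩ := exists_of_fib_pos ((h1m (b + s)).le)
  have e1 : (p : ZMod (p ^ 2)) • (c - b) = (p : ZMod (p ^ 2)) • s := by
    have : c - b = (c - (b + s)) + s := by abel
    rw [this, smul_add, hcs, zero_add]
  have hcb : (p : ZMod (p ^ 2)) • (c - b) ≠ 0 := by rwa [e1]
  have e2 : (p : ZMod (p ^ 2)) * symp (c - b) s = 0 := by
    rw [← symp_smul_left, e1, symp_smul_left, symp_self, mul_zero]
  have hne : c ≠ b := by
    rintro rfl
    rw [sub_self, smul_zero] at hcb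
    exact hcb rfl
  have h4 := (h c hc' b hb hne).p_mul_cos a
  rw [lin_congr hs hcb e2] at h4
  have h5 := hvp.p_mul_lin a
  have h6 : hco A (c - b) a ≤ cos A (c - b) a := hco_le_cos
  rw [hco_congr hs hcb e2, hh, if_pos ha, mul_one] at h6
  have h7 := hmp a
  have h8 := hfib a
  have h9 : p ^ 2 * p ≤ p ^ 2 * cos A (c - b) a := Nat.mul_le_mul_left _ h6
  have h10 : p ^ 2 * cos A (c - b) a = A.card := by rw [← h5, ← h4]; ring
  have e : p ^ 3 = p ^ 2 * p := by ring
  omega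

theorem not_mul_dvd_sq {m : ℕ} (h1 : 1 < m) (h2 : m < p) (h : p * m ∣ p * p) : False := by
  have h3 := Nat.dvd_of_mul_dvd_mul_left hp.out.pos h
  rcases (Nat.dvd_prime hp.out).1 h3 with h4 | h4 <;> omega

theorem lin_le_of_hco (hs : (p : ZMod (p ^ 2)) • s ≠ 0)
    (hm : ∀ a ∈ S, ∀ b ∈ S, symp (a - b) s = 0 → (p : ZMod (p ^ 2)) • (a - b) = 0)
    (hh : ∀ y, (p : ZMod (p ^ 2)) • (y - x) = 0 → 0 < hco S s y) : lin S s x ≤ fib S x := by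
  obtain ⟨t, ht⟩ := exists_symp_eq_one hs
  refine card_le_card fun a ha => ?_
  rw [mem_filter] at ha ⊢
  refine ⟨ha.1, ?_⟩
  -- This point lies in the fibre of `x` and in the coset of ⟨s⟩ through `a`; a point of `S` near it
  -- links `a` to `x`.
  have h1 : (p : ZMod (p ^ 2)) • (x - symp (a - x) s • t - x) = 0 := by
    rw [sub_sub_cancel_left, smul_neg, smul_smul, ha.2, zero_smul, neg_zero]
  obtain ⟨b, hb⟩ := card_pos.1 (hh _ h1)
  rw [mem_filter] at hb
  have h2 := hm a ha.1 b hb.1 (by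
    have h3 := hb.2.2
    simp only [symp_sub_left, symp_smul_left, symp_swap t s, ht] at h3 ⊢
    linear_combination -h3)
  have e : a - x = (a - b) + (b - (x - symp (a - x) s • t)) + (x - symp (a - x) s • t - x) := by
    abel
  rw [e, smul_add, smul_add, h1, hb.2.1, h2]
  simp

/-- In the remaining case all nonempty fibres of both sets have `p` points, and along some `s` all
lines mod p have `p * m` points with `1 < m < p`. A primitive zero whose cosets stay inside fibres
would make `p * m` divide `p²` by `Van.lin_dvd`; such a zero is produced. -/
theorem Orth.false_of_intermediate (h : Orth A S) (h' : Orth S A) (hc : S.card = A.card)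
    (h2 : p ^ 2 < A.card) (h3 : A.card < p ^ 3) : False := by
  by_cases hfS : ∀ s : Plane p, (p : ZMod (p ^ 2)) • s ≠ 0 → Van S ((p : ZMod (p ^ 2)) • s)
  · exact h.not_full_of_lt hc h2 h3 hfS
  by_cases hfA : ∀ s : Plane p, (p : ZMod (p ^ 2)) • s ≠ 0 → Van A ((p : ZMod (p ^ 2)) • s)
  · exact h'.not_full_of_lt hc.symm (by rwa [hc]) (by rwa [hc]) hfA
  push Not at hfS hfA
  obtain ⟨w, hw, hvw⟩ := hfS
  obtain ⟨u, hu, hvu⟩ := hfA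
  have hp0 := hp.out.pos
  have hfibS : ∀ x ∈ S, fib S x = p := fun x hx => le_antisymm (fib_le (h.eq_of_hco hu hvu))
    (Nat.le_of_dvd (fib_pos hx) ⟨_, h'.fib_eq h2 hw hvw x⟩)
  have hfibA : ∀ x ∈ A, fib A x = p := fun x hx => le_antisymm (fib_le (h'.eq_of_hco hw hvw))
    (Nat.le_of_dvd (fib_pos hx) ⟨_, h.fib_eq (by rwa [hc]) hu hvu x⟩)
  obtain ⟨s, hs, hv, hvp⟩ := h.exists_not_van hc h2 h3
  have hmS := h.p_smul_eq_zero hs hv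
  -- Otherwise each fibre meeting `S` meets all its cosets of ⟨p • s⟩, so each line of `S` along `s`
  -- is a single fibre and `#S ≤ p²`.
  have hvpS : Van S ((p : ZMod (p ^ 2)) • s) := by
    by_contra hvpS
    have h4 : ∀ x ∈ S, lin S s x ≤ p := by
      intro x hx
      refine (lin_le_of_hco hs hmS fun y hy => ?_).trans (hfibS x hx).le
      have h5 := h'.fib_eq h2 hs hvpS y
      rw [fib_congr hy, hfibS x hx] at h5
      by_contra! h6
      rw [Nat.le_zero.1 h6] at h5
      omega
    have h5 := card_le_mul_lin h4
    rw [hc, ← pow_two] at h5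
    omega
  obtain ⟨x, hx⟩ : A.Nonempty := card_pos.1 (by omega)
  obtain ⟨y, hy⟩ : S.Nonempty := card_pos.1 (by omega)
  obtain ⟨m, hm⟩ := dvd_lin (x := x) hs (d := p) fun a ha => (hfibA a ha).symm.dvd
  have hlA := fun x => hvp.p_mul_lin x
  have hlS := fun x => hvpS.p_mul_lin x
  have hcard : A.card = p * (p * m) := by rw [← hlA x, hm]
  have hmA : ∀ z, lin A s z = p * m := fun z =>
    Nat.eq_of_mul_eq_mul_left hp0 ((hlA z).trans hcard)
  have hmS' : ∀ z, lin S s z = p * m := fun z =>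
    Nat.eq_of_mul_eq_mul_left hp0 ((hlS z).trans (hc.trans hcard))
  have h1m : 1 < m := by
    by_contra! h0
    have : p * (p * m) ≤ p * (p * 1) := Nat.mul_le_mul_left _ (Nat.mul_le_mul_left _ h0)
    have e : p ^ 2 = p * (p * 1) := by ring
    omega
  have hmp : m < p := by
    by_contra! h0
    have : p * (p * p) ≤ p * (p * m) := Nat.mul_le_mul_left _ (Nat.mul_le_mul_left _ h0)
    have e : p ^ 3 = p * (p * p) := by ring
    omega
  have hvS : ¬ Van S s := by
    intro hvS
    have h4 := hvS.lin_dvd hmS y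
    rw [hmS', hfibS y hy] at h4
    exact not_mul_dvd_sq h1m hmp h4
  have hmA' := h'.p_smul_eq_zero hs hvS
  obtain ⟨a, ha, hay, hay'⟩ := exists_not_fib (A := S) (s := s) (x := y) (by
    rw [hmS', hfibS y hy]
    nlinarith)
  have hvA := h a ha y hy (by
    rintro rfl
    rw [sub_self, smul_zero] at hay'
    exact hay' rfl)
  set r := a - y with hr
  have hlr : ∀ z, lin A r z = p * m := fun z => by rw [lin_congr hs hay' hay, hmA]
  -- For points of `A` on one line mod p, the coset of ⟨s⟩ determines that of ⟨r⟩. Since `A` meets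
  -- all `p` of the latter, the two partitions agree and `hmA'` passes from `s` to `r`.
  have hmr : ∀ b ∈ A, ∀ c ∈ A, symp (b - c) r = 0 → (p : ZMod (p ^ 2)) • (b - c) = 0 := by
    intro b hb c hc' hbc
    refine hmA' b hb c hc' ?_
    rw [symp_sub_left, sub_eq_zero]
    refine eq_of_refines (F := A.filter fun a => (p : ZMod (p ^ 2)) * symp (a - c) s = 0)
      (f := fun a => symp a s) (g := fun a => symp a r) ?_ ?_
      (mem_filter.2 ⟨hb, ?_⟩) (mem_filter.2 ⟨hc', by simp [symp_zero_left]⟩) ?_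
    · intro d hd e he hde
      have h4 : symp (d - e) s = 0 := by rw [symp_sub_left, sub_eq_zero]; exact hde
      have h5 := hmA' d (mem_filter.1 hd).1 e (mem_filter.1 he).1 h4
      have h6 := (symp_iff_of_p_smul hs hay' hay h5).2 h4
      rwa [symp_sub_left, sub_eq_zero] at h6
    · refine (card_image_symp_le c).trans ?_
      have h4 : ((pMultiples p).image fun d => symp c r + d).card = p := by
        rw [card_image_of_injective _ (add_right_injective _), card_pMultiples]
      refine h4.ge.trans (card_le_card fun d hd => ?_)
      obtain ⟨q, hq, rfl⟩ := mem_image.1 hd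
      obtain ⟨t, ht⟩ := exists_symp_eq_one hay'
      have h5 : 0 < cos A r (c - q • t) := by
        have := hvA.p_mul_cos (c - q • t)
        rw [hlr] at this
        rw [Nat.eq_of_mul_eq_mul_left hp0 this]
        omega
      obtain ⟨e, he⟩ := card_pos.1 h5
      rw [mem_filter] at he
      have h6 := he.2
      simp only [symp_sub_left, symp_smul_left, symp_swap t r, ht] at h6
      refine mem_image.2 ⟨e, mem_filter.2 ⟨he.1, ?_⟩, ?_⟩
      · rw [← p_mul_symp_iff hs hay' hay, symp_sub_left]
        linear_combination (p : ZMod (p ^ 2)) * h6 + mem_pMultiples.1 hq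
      · linear_combination h6
    · rw [← p_mul_symp_iff hs hay' hay, hbc, mul_zero]
    · rwa [symp_sub_left, sub_eq_zero] at hbc
  have h4 := hvA.lin_dvd hmr x
  rw [hlr, hfibA x hx] at h4
  exact not_mul_dvd_sq h1m hmp h4

end IntermediateSizes

/-! ### Spectral sets of size at most `p²`, and the case distinction by size -/

section SmallSizes

variable {p : ℕ} [hp : Fact p.Prime] {A S : Finset (Plane p)} {s t x : Plane p}

/-- Nonempty fibres have `p` points, as do lines mod p along any zero `p • r`. Take two congruent
points with difference `p • k`. If `p • k` were no zero, the fibre would have one point per coset of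
⟨p • k⟩. If some `s'` parallel to `k` were a zero, the line would have one point per coset of ⟨s'⟩.
Both contradict the chosen pair. -/
theorem exists_direction (hcard : S.card = p ^ 2)
    (hw : ∀ w : Plane p, (p : ZMod (p ^ 2)) • w ≠ 0 → ¬ Van S ((p : ZMod (p ^ 2)) • w) →
      ∀ x, fib S x = p * hco S w x)
    {w : Plane p} (hw0 : (p : ZMod (p ^ 2)) • w ≠ 0) (hvw : ¬ Van S ((p : ZMod (p ^ 2)) • w))
    {r : Plane p} (hvr : Van S ((p : ZMod (p ^ 2)) • r))
    (hS : ¬ ∀ a ∈ S, ∀ b ∈ S, (p : ZMod (p ^ 2)) • (a - b) = 0 → a = b) :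
    ∃ k : Plane p, (p : ZMod (p ^ 2)) • k ≠ 0 ∧ Van S ((p : ZMod (p ^ 2)) • k) ∧
      ∀ s' : Plane p, (p : ZMod (p ^ 2)) • s' ≠ 0 → (p : ZMod (p ^ 2)) * symp s' k = 0 →
        ¬ Van S s' := by
  have hp2 := hp.out.two_le
  have hlin : ∀ s, Van S ((p : ZMod (p ^ 2)) • s) → ∀ x, lin S s x = p := by
    intro s hs x
    have := hs.p_mul_lin x
    rw [hcard, pow_two] at this
    exact Nat.eq_of_mul_eq_mul_left hp.out.pos this
  have hfib : ∀ x ∈ S, fib S x = p := fun x hx => le_antisymm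
    (fib_le_lin.trans (hlin r hvr x).le) (Nat.le_of_dvd (fib_pos hx) ⟨_, hw w hw0 hvw x⟩)
  push Not at hS
  obtain ⟨a, ha, b, hb, hab, hne⟩ := hS
  obtain ⟨k, hk⟩ := exists_eq_p_smul hab
  have hk0 : (p : ZMod (p ^ 2)) • k ≠ 0 := by
    rw [← hk]
    exact sub_ne_zero.2 hne
  have hak : symp (a - b) k = 0 := by rw [hk, symp_smul_left, symp_self, mul_zero]
  have hvk : Van S ((p : ZMod (p ^ 2)) • k) := by
    by_contra hvk
    have h1 := hw k hk0 hvk b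
    have h2 : 2 ≤ hco S k b := two_le_card_filter ha hb hne ⟨hab, hak⟩ (by simp [symp_zero_left])
    rw [hfib b hb] at h1
    nlinarith
  refine ⟨k, hk0, hvk, fun s' hs' hsk hv => ?_⟩
  have h1 := hv.p_mul_cos b
  rw [lin_congr hk0 hs' hsk, hlin k hvk] at h1
  have h2 := two_le_cos ha hb hne ((symp_iff_of_p_smul hk0 hs' hsk hab).2 hak)
  nlinarith

/-- The complement is a cyclic group ⟨s⟩, or `S` itself, or `p • G`. When these fail,
`exists_direction` applies to `S`, and the complement combines multiples of `p • w` with digit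
multiples of `k`. -/
theorem Orth.isTile_of_card_eq_sq (h' : Orth S A) (hc : S.card = A.card)
    (hA : A.card = p ^ 2) : IsTile A := by
  have hp2 := hp.out.two_le
  by_cases c1 : ∃ s : Plane p, (p : ZMod (p ^ 2)) • s ≠ 0 ∧
      ∀ a ∈ A, ∀ b ∈ A, symp (a - b) s = 0 → a = b
  · obtain ⟨s, hs, hm⟩ := c1
    obtain ⟨t, ht⟩ := exists_symp_eq_one hs
    refine isTile_of_combos (s := s) (t := t) (X := univ) (Y := {0}) ?_ ?_ ?_
    · rw [ht, mul_one]; exact ZMod.sq_cast_ne_zero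
    · rw [hA, card_univ_sq, card_singleton]; ring
    · intro c hc d hd x _ x' _ y hy y' hy' e
      rw [mem_singleton] at hy hy'
      rw [hy, hy', sub_self, zero_smul, add_zero] at e
      exact hm c hc d hd (by rw [e, symp_smul_left, symp_self, mul_zero])
  by_cases c2 : ∀ a ∈ S, ∀ b ∈ S, (p : ZMod (p ^ 2)) • (a - b) = 0 → a = b
  · refine isTile_of_card_mul (B := S) (by rw [hc, hA]; ring) ?_
    intro a ha a' ha' b hb b' hb' e
    by_contra hne
    have hne' : b ≠ b' := by
      rintro rfl
      rw [sub_self] at e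
      exact hne (sub_eq_zero.1 e)
    have hb0 : (p : ZMod (p ^ 2)) • (b - b') ≠ 0 := fun h0 => hne' (c2 b hb b' hb' h0)
    have hv := h' a ha a' ha' hne
    rw [e] at hv
    have h1 := hv.p_mul_cos b'
    have h2 : lin S (b - b') b' ≤ p * 1 := lin_le_mul hb0 fun a _ => fib_le_one c2
    have h3 := two_le_cos hb hb' hne' (symp_self (b - b'))
    nlinarith
  by_cases c3 : ∀ a ∈ A, ∀ b ∈ A, (p : ZMod (p ^ 2)) • (a - b) = 0 → a = b
  · obtain ⟨s, t, ht⟩ := exists_basis p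
    refine isTile_of_combos (s := s) (t := t) (X := pMultiples p) (Y := pMultiples p) ?_ ?_ ?_
    · rw [ht, mul_one]; exact ZMod.sq_cast_ne_zero
    · rw [hA, card_pMultiples]; ring
    · intro c hc d hd x hx x' hx' y hy y' hy' e
      refine c3 c hc d hd ?_
      rw [e, smul_add, smul_smul, smul_smul, pMultiple_sub hx hx', pMultiple_sub hy hy']
      simp
  obtain ⟨w, hw, hvw⟩ : ∃ w : Plane p, (p : ZMod (p ^ 2)) • w ≠ 0 ∧
      ¬ Van S ((p : ZMod (p ^ 2)) • w) := by
    by_contra! hfull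
    apply c2
    intro a ha b hb hab
    by_contra hne
    have h1 := card_eq_p_sq_mul_fib hfull b
    have h2 : 2 ≤ fib S b := two_le_card_filter ha hb hne hab (by simp)
    rw [hc, hA] at h1
    have : 0 < p ^ 2 := by positivity
    nlinarith
  obtain ⟨-, -, -, -, -, r, -, -, hvr⟩ := h'.exists_p_smul c3
  have hfib : ∀ w : Plane p, (p : ZMod (p ^ 2)) • w ≠ 0 → ¬ Van S ((p : ZMod (p ^ 2)) • w) →
      ∀ x, fib S x = p * hco S w x := by
    intro w hw hvw
    refine fib_eq_p_mul_hco hw fun s' hs' hsw => ?_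
    -- The failure of `c1` puts two points of `A` in one coset of ⟨s'⟩. Their difference is
    -- primitive because of `hvw`, so `s'` is a zero of `S`.
    push Not at c1
    obtain ⟨a, ha, b, hb, hab, hne⟩ := c1 s' hs'
    have hab0 : (p : ZMod (p ^ 2)) • (a - b) ≠ 0 := fun h0 =>
      hne (h'.eq_of_hco hw hvw a ha b hb h0 ((symp_iff_of_p_smul hw hs' hsw h0).1 hab))
    exact (van_iff_of_symp_eq_zero hs' hab0 hab).1 (h' a ha b hb hne)
  obtain ⟨k, hk, hvk, hk'⟩ := exists_direction (hc.trans hA) hfib hw hvw hvr c2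
  have hmA := h'.p_smul_eq_zero_of_lin hk'
  have hwA := h'.eq_of_hco hw hvw
  refine isTile_of_combos (s := w) (t := k) (X := pMultiples p) (Y := digits p) ?_ ?_ ?_
  · intro h0
    exact hvw ((van_p_smul_iff hk hw h0).2 hvk)
  · rw [hA, card_pMultiples, card_digits]; ring
  · intro c hc d hd x hx x' hx' y hy y' hy' e
    have h1 : (p : ZMod (p ^ 2)) • (c - d) = (p : ZMod (p ^ 2)) • ((y - y') • k) := by
      rw [e, smul_add, smul_smul _ (x - x'), pMultiple_sub hx hx', zero_smul, zero_add]
    have h2 := hmA c hc d hd (by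
      rw [← symp_smul_left, h1, symp_smul_left, symp_smul_left, symp_self, mul_zero, mul_zero])
    rcases digit_sub hy hy' with h0 | h0
    · rw [h0, sub_self, zero_smul, add_zero] at e
      exact hwA c hc d hd h2 (by rw [e, symp_smul_left, symp_self, mul_zero])
    · rw [h1] at h2
      exact absurd h2 (p_smul_ne_zero_of_isUnit h0 hk)

/-- Pigeonhole realises every direction mod p by a primitive difference of `S`, so each of the `p +
1` lines mod p through `x` has exactly `p` points of `A`, with only the fibre of `x`, a single
point, in common. -/
theorem Orth.p_sq_le_card (h : Orth A S) (hS : p < S.card) (hA : A.Nonempty)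
    (hiA : ∀ a ∈ A, ∀ b ∈ A, (p : ZMod (p ^ 2)) • (a - b) = 0 → a = b)
    (hiS : ∀ a ∈ S, ∀ b ∈ S, (p : ZMod (p ^ 2)) • (a - b) = 0 → a = b) : p ^ 2 ≤ A.card := by
  obtain ⟨x, hx⟩ := hA
  have hlin : ∀ s : Plane p, (p : ZMod (p ^ 2)) • s ≠ 0 → lin A s x = p := by
    intro s hs
    obtain ⟨a, ha, b, hb, hne, hab⟩ := exists_ne_lin hS s
    have hab0 : (p : ZMod (p ^ 2)) • (a - b) ≠ 0 := fun h0 => hne (hiS a ha b hb h0)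
    have h1 := (h a ha b hb hne).p_mul_cos x
    rw [lin_congr hs hab0 hab] at h1
    have h2 : lin A s x ≤ p * 1 := lin_le_mul hs fun a _ => fib_le_one hiA
    have h3 := Nat.le_of_dvd (lin_pos (s := s) hx) ⟨_, h1.symm⟩
    omega
  obtain ⟨s, t, ht⟩ := exists_basis p
  have h1 := sum_lin_add_lin (A := A) ht x
  rw [sum_congr rfl fun k _ => hlin _ (p_smul_ne_zero_of_symp (symp_add_smul_self ht k)),
    hlin _ (p_smul_ne_zero_of_symp' ht), sum_const, card_digits, smul_eq_mul] at h1
  have h2 : fib A x ≤ 1 := fib_le_one hiA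
  nlinarith

theorem not_van_of_small {M : ℕ} (hM : M < p) (hS : S.Nonempty) {r : Plane p}
    (hr : (p : ZMod (p ^ 2)) • r ≠ 0) (hlin : ∀ x, lin S r x = M) (s' : Plane p)
    (hs' : (p : ZMod (p ^ 2)) • s' ≠ 0) (hsr : (p : ZMod (p ^ 2)) * symp s' r = 0) :
    ¬ Van S s' := by
  intro hv
  obtain ⟨x, hx⟩ := hS
  have h1 := hv.p_mul_cos x
  have h2 := Nat.le_of_dvd (lin_pos (s := s') hx) ⟨_, h1.symm⟩
  rw [lin_congr hr hs' hsr, hlin] at h2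
  omega

/-- Two congruent points of `A` give a direction `r` along which `S` has lines too small for
primitive zeros, so each line of `A` along `r` is one fibre, of at most `p` points. A primitive
difference of `S` along `r` spreads that line evenly over `p` cosets, one of which holds the pair:
at least `2 * p` points. -/
theorem false_of_one_sided (h : Orth A S) (h' : Orth S A) (hA : p < S.card)
    (hiS : ∀ a ∈ S, ∀ b ∈ S, (p : ZMod (p ^ 2)) • (a - b) = 0 → a = b)
    (hiA : ¬ ∀ a ∈ A, ∀ b ∈ A, (p : ZMod (p ^ 2)) • (a - b) = 0 → a = b)
    {w : Plane p} (hw : (p : ZMod (p ^ 2)) • w ≠ 0) (hvw : ¬ Van S ((p : ZMod (p ^ 2)) • w))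
    {M : ℕ} (hM : S.card = p * M) (hMp : M < p) : False := by
  obtain ⟨a, ha, b, hb, hne, r, hr, hab, hvr⟩ := h'.exists_p_smul hiA
  have hS : S.Nonempty := card_pos.1 (by omega)
  have hlin : ∀ x, lin S r x = M := fun x =>
    Nat.eq_of_mul_eq_mul_left hp.out.pos ((hvr.p_mul_lin x).trans hM)
  have hmA := h'.p_smul_eq_zero_of_lin (not_van_of_small hMp hS hr hlin)
  obtain ⟨c, hc, d, hd, hcd, hcd'⟩ := exists_ne_lin hA r
  have hcd0 : (p : ZMod (p ^ 2)) • (c - d) ≠ 0 := fun h0 => hcd (hiS c hc d hd h0)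
  have h1 := (h c hc d hd hcd).p_mul_cos b
  rw [lin_congr hr hcd0 hcd'] at h1
  have hab0 : (p : ZMod (p ^ 2)) • (a - b) = 0 := by rw [hab, p_smul_p_smul]
  have h2 := two_le_cos ha hb hne ((symp_iff_of_p_smul hr hcd0 hcd' hab0).2
    (by rw [hab, symp_smul_left, symp_self, mul_zero]))
  have h3 : lin A r b ≤ fib A b := card_le_card fun e he => by
    rw [mem_filter] at he ⊢
    exact ⟨he.1, hmA e he.1 b hb he.2⟩
  have h4 : fib A b ≤ p := fib_le (h'.eq_of_hco hw hvw)
  have := hp.out.pos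
  nlinarith

/-- The line along `q` determines the fibre, hence the line along `r`. At most `p` lines along `q`
and all `p` along `r` meet `S`, so the line along `r` determines the one along `q`. -/
theorem p_smul_of_lin_pos {r q : Plane p} (hpos : ∀ x, 0 < lin S r x)
    (hr : (p : ZMod (p ^ 2)) • r ≠ 0)
    (hm : ∀ a ∈ S, ∀ b ∈ S, (p : ZMod (p ^ 2)) * symp (a - b) q = 0 →
      (p : ZMod (p ^ 2)) • (a - b) = 0) :
    ∀ a ∈ S, ∀ b ∈ S, (p : ZMod (p ^ 2)) * symp (a - b) r = 0 →
      (p : ZMod (p ^ 2)) • (a - b) = 0 := by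
  intro a ha b hb hab
  refine hm a ha b hb ?_
  rw [symp_sub_left, mul_sub, sub_eq_zero]
  refine eq_of_refines (F := S) (f := fun a => (p : ZMod (p ^ 2)) * symp a q)
    (g := fun a => (p : ZMod (p ^ 2)) * symp a r) ?_ ?_ ha hb ?_
  · intro c hc d hd hcd
    have h1 := hm c hc d hd (by rw [symp_sub_left, mul_sub, sub_eq_zero]; exact hcd)
    rw [← sub_eq_zero, ← mul_sub, ← symp_sub_left, ← symp_smul_left, h1, symp_zero_left]
  · have h1 : (S.image fun a => (p : ZMod (p ^ 2)) * symp a q).card ≤ p := by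
      conv_rhs => rw [← card_pMultiples (p := p)]
      refine card_le_card fun c hc => ?_
      obtain ⟨d, -, rfl⟩ := mem_image.1 hc
      exact p_mul_mem_pMultiples _
    refine h1.trans ?_
    conv_lhs => rw [← card_pMultiples (p := p)]
    refine card_le_card fun c hc => ?_
    obtain ⟨d, rfl⟩ := ZMod.exists_of_p_mul_eq_zero (mem_pMultiples.1 hc)
    obtain ⟨t, ht⟩ := exists_symp_eq_one hr
    obtain ⟨e, he⟩ := card_pos.1 (hpos (-d • t))
    rw [mem_filter, symp_sub_left, symp_smul_left, symp_swap t, ht] at he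
    refine mem_image.2 ⟨e, he.1, ?_⟩
    linear_combination he.2
  · rw [symp_sub_left, mul_sub, sub_eq_zero] at hab
    exact hab

theorem lin_eq_fib_of_p_smul {r : Plane p}
    (hm : ∀ a ∈ S, ∀ b ∈ S, (p : ZMod (p ^ 2)) * symp (a - b) r = 0 →
      (p : ZMod (p ^ 2)) • (a - b) = 0) (hx : x ∈ S) : fib S x = lin S r x :=
  le_antisymm fib_le_lin (card_le_card fun e he => by
    rw [mem_filter] at he ⊢
    exact ⟨he.1, hm e he.1 x hx he.2⟩)

/-- If all fibres of `A` have `M < p` points and `#A = p * M`, then `A` lies on a line in the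
direction of any difference of frequencies. -/
theorem lin_eq_card_of_van {M : ℕ} (hM : A.card = p * M) (hMp : M < p)
    (hfib : ∀ x ∈ A, fib A x = M) (hs : (p : ZMod (p ^ 2)) • s ≠ 0) (hv : Van A s) (hx : x ∈ A) :
    lin A s x = A.card := by
  have h0 : 0 < M := by rw [← hfib x hx]; exact fib_pos hx
  have h1 : p ∣ lin A s x := ⟨_, (hv.p_mul_cos x).symm⟩
  have h2 : M ∣ lin A s x := dvd_lin hs fun a ha => (hfib a ha).symm.dvd
  have h3 : Nat.Coprime p M := (Nat.coprime_of_lt_prime h0.ne' hMp hp.out)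
  have h4 := Nat.le_of_dvd (lin_pos hx) (h3.mul_dvd_of_dvd_of_dvd h1 h2)
  exact le_antisymm (card_filter_le _ _) (by rw [hM]; exact h4)

theorem exists_not_fib_of_card (hx : x ∈ S) (h : fib S x < S.card) :
    ∃ a ∈ S, a ≠ x ∧ (p : ZMod (p ^ 2)) • (a - x) ≠ 0 := by
  obtain ⟨a, ha, ha'⟩ := exists_mem_notMem_of_card_lt_card h
  have h1 : (p : ZMod (p ^ 2)) • (a - x) ≠ 0 := fun h0 => ha' (mem_filter.2 ⟨ha, h0⟩)
  refine ⟨a, ha, ?_, h1⟩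
  rintro rfl
  simp at h1

/-- All nonempty fibres have `M` points, which is prime to `p`, so a primitive zero forces each set
onto one line mod p, with a common direction. On that line the missing zeros of `A` leave `S` at
most one point in each of `p` cosets, although `#S > p`. -/
theorem false_of_two_sided (h : Orth A S) (h' : Orth S A) (hc : S.card = A.card)
    (hA : p < A.card)
    (hiS : ¬ ∀ a ∈ S, ∀ b ∈ S, (p : ZMod (p ^ 2)) • (a - b) = 0 → a = b)
    (hiA : ¬ ∀ a ∈ A, ∀ b ∈ A, (p : ZMod (p ^ 2)) • (a - b) = 0 → a = b)
    {M : ℕ} (hM : A.card = p * M) (hMp : M < p) : False := by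
  have hp0 := hp.out.pos
  have hp2 := hp.out.two_le
  have hM0 : 1 < M := by nlinarith
  obtain ⟨-, -, -, -, -, r, hr, -, hvr⟩ := h'.exists_p_smul hiA
  obtain ⟨-, -, -, -, -, q, hq, -, hvq⟩ := h.exists_p_smul hiS
  obtain ⟨y, hy⟩ : S.Nonempty := card_pos.1 (by omega)
  obtain ⟨x, hx⟩ : A.Nonempty := card_pos.1 (by omega)
  have hlS : ∀ x, lin S r x = M := fun x =>
    Nat.eq_of_mul_eq_mul_left hp0 ((hvr.p_mul_lin x).trans (hc.trans hM))
  have hlA : ∀ x, lin A q x = M := fun x =>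
    Nat.eq_of_mul_eq_mul_left hp0 ((hvq.p_mul_lin x).trans hM)
  have hmA := h'.p_smul_eq_zero_of_lin (not_van_of_small hMp ⟨y, hy⟩ hr hlS)
  have hmS := h.p_smul_eq_zero_of_lin (not_van_of_small hMp ⟨x, hx⟩ hq hlA)
  have hmS' := p_smul_of_lin_pos (fun x => by rw [hlS]; omega) hr hmS
  have hmA' := p_smul_of_lin_pos (fun x => by rw [hlA]; omega) hq hmA
  have hfS : ∀ x ∈ S, fib S x = M := fun x hx => by rw [lin_eq_fib_of_p_smul hmS' hx, hlS]
  have hfA : ∀ x ∈ A, fib A x = M := fun x hx => by rw [lin_eq_fib_of_p_smul hmA' hx, hlA]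
  have hMlt : M < A.card := by nlinarith
  obtain ⟨a, ha, hay, hs⟩ := exists_not_fib_of_card hy (by rwa [hfS y hy, hc])
  obtain ⟨b, hb, hbx, hs'⟩ := exists_not_fib_of_card hx (by rwa [hfA x hx])
  have hlinA : ∀ z ∈ A, lin A (a - y) z = A.card := fun z hz =>
    lin_eq_card_of_van hM hMp hfA hs (h a ha y hy hay) hz
  have hlinS : ∀ z ∈ S, lin S (b - x) z = S.card := fun z hz =>
    lin_eq_card_of_van (hc.trans hM) hMp hfS hs' (h' b hb x hx hbx) hz
  have hbs : (p : ZMod (p ^ 2)) * symp (b - x) (a - y) = 0 := by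
    have := filter_card_eq (hlinA x hx)
    exact this b hb
  have hlinS' : ∀ z ∈ S, lin S (a - y) z = S.card := fun z hz => by
    rw [← lin_congr hs hs' hbs, hlinS z hz]
  have hnA : ¬ Van A ((p : ZMod (p ^ 2)) • (a - y)) := by
    intro hv
    have := hv.p_mul_lin x
    rw [hlinA x hx] at this
    nlinarith
  have hinj := h.eq_of_hco hs hnA
  -- If all lifts of this direction were zeros of `A`, then `p` would divide the fibre size `M`.
  obtain ⟨s', hs0, hss, hns⟩ : ∃ s' : Plane p, (p : ZMod (p ^ 2)) • s' ≠ 0 ∧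
      (p : ZMod (p ^ 2)) * symp s' (a - y) = 0 ∧ ¬ Van A s' := by
    by_contra! hv
    have h1 := fib_eq_p_mul_hco hs hv x
    rw [hfA x hx] at h1
    have := Nat.le_of_dvd (by omega) ⟨_, h1⟩
    omega
  have hm := h.p_smul_eq_zero hs0 hns
  have h1 : lin S s' y ≤ p := by
    rw [lin, ← card_image_of_injOn (f := fun a => symp a s') ?_]
    · exact card_image_symp_le y
    · intro c hc d hd hcd
      have hc' := (mem_filter.1 (mem_coe.1 hc)).1
      have hd' := (mem_filter.1 (mem_coe.1 hd)).1
      have h2 : symp (c - d) s' = 0 := by rw [symp_sub_left, sub_eq_zero]; exact hcd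
      have h3 := hm c hc' d hd' h2
      exact hinj c hc' d hd' h3 ((symp_iff_of_p_smul hs hs0 hss h3).1 h2)
  rw [lin_congr hs hs0 hss, hlinS' y hy] at h1
  omega

theorem Orth.false_of_lt_sq (h : Orth A S) (h' : Orth S A) (hc : S.card = A.card)
    (hA : p < A.card) (hA2 : A.card < p ^ 2) (hdvd : p ∣ A.card) : False := by
  obtain ⟨M, hM⟩ := hdvd
  have hMp : M < p := by
    rw [hM, pow_two] at hA2
    exact lt_of_mul_lt_mul_left hA2 (Nat.zero_le p)
  have hnot : ∀ T : Finset (Plane p), T.card = A.card → ∃ w : Plane p,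
      (p : ZMod (p ^ 2)) • w ≠ 0 ∧ ¬ Van T ((p : ZMod (p ^ 2)) • w) := by
    intro T hT
    by_contra! hv
    have h1 := card_eq_p_sq_mul_fib hv 0
    have := Nat.le_of_dvd (by omega) ⟨_, h1⟩
    omega
  obtain ⟨w, hw, hvw⟩ := hnot S hc
  obtain ⟨u, hu, hvu⟩ := hnot A rfl
  by_cases hiS : ∀ a ∈ S, ∀ b ∈ S, (p : ZMod (p ^ 2)) • (a - b) = 0 → a = b
  · by_cases hiA : ∀ a ∈ A, ∀ b ∈ A, (p : ZMod (p ^ 2)) • (a - b) = 0 → a = b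
    · have := h.p_sq_le_card (by rwa [hc]) (card_pos.1 (by omega)) hiA hiS
      omega
    · exact false_of_one_sided h h' (by rwa [hc]) hiS hiA hw hvw (hc.trans hM) hMp
  · by_cases hiA : ∀ a ∈ A, ∀ b ∈ A, (p : ZMod (p ^ 2)) • (a - b) = 0 → a = b
    · exact false_of_one_sided h' h hA hiA hiS hu hvu hM hMp
    · exact false_of_two_sided h h' hc hA hiS hiA hM hMp

/-- A zero `p • s` puts one point of `A` on each line mod p along `s`; a primitive zero `v` puts `A`
on one line mod p, with one point in each coset of ⟨v⟩. Either shape dictates the complement. -/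
theorem Van.isTile_of_card_eq (hA : A.card = p) {v : Plane p} (hv0 : v ≠ 0) (hv : Van A v) :
    IsTile A := by
  have hp2 := hp.out.two_le
  by_cases hp0 : (p : ZMod (p ^ 2)) • v = 0
  · obtain ⟨s, rfl⟩ := exists_eq_p_smul hp0
    obtain ⟨t, ht⟩ := exists_symp_eq_one hv0
    refine isTile_of_combos (s := s) (t := t) (X := univ) (Y := pMultiples p) ?_ ?_ ?_
    · rw [ht, mul_one]; exact ZMod.sq_cast_ne_zero
    · rw [hA, card_univ_sq, card_pMultiples]; ring
    · intro c hc d hd x _ x' _ y hy y' hy' e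
      by_contra hne
      have h1 := hv.p_mul_lin d
      have h2 : 2 ≤ lin A s d := by
        refine two_le_card_filter hc hd hne ?_ (by simp [symp_zero_left])
        rw [e, symp_add_left, symp_smul_left, symp_smul_left, symp_self, mul_zero, zero_add,
          ← mul_assoc, pMultiple_sub hy hy', zero_mul]
      nlinarith
  · obtain ⟨t, ht⟩ := exists_symp_eq_one hp0
    refine isTile_of_combos (s := v) (t := t) (X := univ) (Y := digits p) ?_ ?_ ?_
    · rw [ht, mul_one]; exact ZMod.sq_cast_ne_zero
    · rw [hA, card_univ_sq, card_digits]; ring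
    · intro c hc d hd x _ x' _ y hy y' hy' e
      have h1 := hv.p_mul_cos d
      have h2 : lin A v d ≤ A.card := card_filter_le _ _
      have h3 := Nat.le_of_dvd (lin_pos (s := v) hd) ⟨_, h1.symm⟩
      have h4 := filter_card_eq (le_antisymm h2 (by rwa [hA])) c hc
      have h5 : symp (c - d) v = -(y - y') := by
        rw [e, symp_add_left, symp_smul_left, symp_smul_left, symp_self, symp_swap t, ht]
        ring
      have h6 : y = y' := digit_unique hy hy' (by
        rw [h5] at h4
        linear_combination -h4)
      rw [h6, sub_self, neg_zero] at h5
      by_contra hne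
      have h7 := two_le_cos hc hd hne h5
      nlinarith

theorem Orth.isTile (h : Orth A S) (hc : S.card = A.card) (hA : A.Nonempty) : IsTile A := by
  have h' := h.symm hc hA
  rcases Nat.lt_or_ge 1 S.card with h1 | h1
  · obtain ⟨a, ha, b, hb, hab⟩ := one_lt_card.1 h1
    have hv := h a ha b hb hab
    have hdvd := hv.p_dvd_card
    rcases (Nat.le_of_dvd hA.card_pos hdvd).eq_or_lt with h2 | h2
    · exact hv.isTile_of_card_eq h2.symm (sub_ne_zero.2 hab)
    rcases lt_trichotomy A.card (p ^ 2) with h3 | h3 | h3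
    · exact (h.false_of_lt_sq h' hc h2 h3 hdvd).elim
    · exact h'.isTile_of_card_eq_sq hc h3
    rcases lt_trichotomy A.card (p ^ 3) with h4 | h4 | h4
    · exact (h.false_of_intermediate h' hc h3 h4).elim
    · exact h.isTile_of_card_eq_cube h' hc h4
    · exact h.isTile_of_lt h' hc h4
  · exact isTile_of_card_one (by have := hA.card_pos; omega)

end SmallSizes

/-! ### Tiles: explicit spectra for each power of `p` -/

section TileToSpectral

variable {p : ℕ} [hp : Fact p.Prime] {A B : Finset (Plane p)} {s t x : Plane p}

theorem exists_orth_of_combos {X Y : Finset (ZMod (p ^ 2))}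
    (hst : (p : ZMod (p ^ 2)) * symp s t ≠ 0) (hcard : X.card * Y.card = A.card)
    (h : ∀ x ∈ X, ∀ x' ∈ X, ∀ y ∈ Y, ∀ y' ∈ Y, (x - x') • s + (y - y') • t ≠ 0 →
      Van A ((x - x') • s + (y - y') • t)) :
    ∃ S : Finset (Plane p), S.card = A.card ∧ Orth A S := by
  refine ⟨combos X Y s t, by rw [card_combos hst, hcard], ?_⟩
  intro a ha b hb hab
  obtain ⟨x, hx, x', hx', y, hy, y', hy', e⟩ := exists_of_mem_combos ha hb
  rw [e]
  refine h x hx x' hx' y hy y' hy' ?_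
  rw [← e]
  exact sub_ne_zero.2 hab

theorem Van.of_p_smul {d : Plane p} (hv : Van A ((p : ZMod (p ^ 2)) • s))
    (hs : (p : ZMod (p ^ 2)) • s ≠ 0) (hd : d ≠ 0) (hpd : (p : ZMod (p ^ 2)) • d = 0)
    (hds : symp d s = 0) : Van A d := by
  obtain ⟨z, rfl⟩ := exists_eq_p_smul hpd
  rw [symp_smul_left] at hds
  exact (van_p_smul_iff hs hd hds).2 hv

/-- The coefficients vanish along a full cyclic group. -/
theorem Van.of_symp_eq_zero {d : Plane p} (hv : Van A s)
    (hvp : Van A ((p : ZMod (p ^ 2)) • s)) (hs : (p : ZMod (p ^ 2)) • s ≠ 0) (hd : d ≠ 0)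
    (hds : symp d s = 0) : Van A d := by
  by_cases hpd : (p : ZMod (p ^ 2)) • d = 0
  · exact hvp.of_p_smul hs hd hpd hds
  · exact (van_iff_of_symp_eq_zero hs hpd hds).2 hv

theorem exists_orth_of_card_one (hA : A.card = 1) :
    ∃ S : Finset (Plane p), S.card = A.card ∧ Orth A S := by
  refine ⟨{0}, by rw [hA, card_singleton], ?_⟩
  intro a ha b hb hab
  rw [mem_singleton] at ha hb
  exact absurd (ha.trans hb.symm) hab

theorem exists_orth_of_card_eq (hA : A.card = p ^ 4) :
    ∃ S : Finset (Plane p), S.card = A.card ∧ Orth A S := by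
  rw [← card_plane, card_eq_iff_eq_univ] at hA
  subst hA
  exact ⟨univ, rfl, fun a _ b _ hab =>
    sympFourier_eq_zero_iff.1 (sympFourier_univ (sub_ne_zero.2 hab))⟩

theorem exists_orth_of_card_eq_p (hA : A.card = p) (hcard : A.card * B.card = p ^ 4)
    (h : ∀ s, s ≠ 0 → Van A s ∨ Van B s) :
    ∃ S : Finset (Plane p), S.card = A.card ∧ Orth A S := by
  have hp2 := hp.out.two_le
  obtain ⟨s, hs, hv⟩ : ∃ s, s ≠ 0 ∧ Van A s := by
    by_contra! hv
    -- Without zeros of `A`, all nonzero frequencies would be zeros of `B`, so `#B = p ^ 4`,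
    -- contradicting `#A = p`.
    have hB : ∀ s, s ≠ 0 → Van B s := fun s hs => (h s hs).resolve_left (hv s hs)
    have hB0 : B.card ≠ 0 := by
      intro h0
      rw [h0, mul_zero] at hcard
      exact pow_ne_zero 4 hp.out.ne_zero hcard.symm
    obtain ⟨b, hb⟩ := card_pos.1 (Nat.pos_of_ne_zero hB0)
    have h1 := card_eq_p_sq_mul_fib (fun s hs => hB _ hs) b
    rw [fib_eq_of_van_prim (fun s hs => hB s (by rintro rfl; simp at hs)), if_pos hb] at h1
    rw [h1, hA] at hcard
    have h2 : p ^ 4 * p = p ^ 4 * 1 := by linarith [show p * (p ^ 2 * (p ^ 2 * 1)) = p ^ 4 * p by ring]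
    have := Nat.eq_of_mul_eq_mul_left (by positivity) h2
    omega
  by_cases hps : (p : ZMod (p ^ 2)) • s = 0
  · obtain ⟨r, rfl⟩ := exists_eq_p_smul hps
    obtain ⟨t, ht⟩ := exists_symp_eq_one hs
    refine exists_orth_of_combos (s := r) (t := t) (X := pMultiples p) (Y := {0}) ?_ ?_ ?_
    · rw [ht, mul_one]; exact ZMod.sq_cast_ne_zero
    · rw [hA, card_pMultiples, card_singleton, mul_one]
    · intro x hx x' hx' y hy y' hy' hd
      rw [mem_singleton] at hy hy'
      rw [hy, hy', sub_self, zero_smul, add_zero] at hd ⊢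
      refine hv.of_p_smul hs hd ?_ (by rw [symp_smul_left, symp_self, mul_zero])
      rw [smul_smul, pMultiple_sub hx hx', zero_smul]
  · obtain ⟨t, ht⟩ := exists_symp_eq_one hps
    refine exists_orth_of_combos (s := s) (t := t) (X := digits p) (Y := {0}) ?_ ?_ ?_
    · rw [ht, mul_one]; exact ZMod.sq_cast_ne_zero
    · rw [hA, card_digits, card_singleton, mul_one]
    · intro x hx x' hx' y hy y' hy' hd
      rw [mem_singleton] at hy hy'
      rw [hy, hy', sub_self, zero_smul, add_zero] at hd ⊢
      rcases digit_sub hx hx' with h0 | h0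
      · rw [h0, sub_self, zero_smul] at hd
        exact absurd rfl hd
      · exact hv.smul h0

/-- With `#B = p`, a zero of `B` at `p • s` requires one point of `B` per line mod p, and a
primitive zero requires all of `B` on one line in distinct cosets. A single pair in `B` excludes
many zeros, which `A` must then have; whether all of `B` lies in one fibre decides which frequencies
to use. -/
theorem exists_orth_of_card_eq_cube (hA : A.card = p ^ 3) (hB : B.card = p)
    (h : ∀ s, s ≠ 0 → Van A s ∨ Van B s) :
    ∃ S : Finset (Plane p), S.card = A.card ∧ Orth A S := by
  have hp2 := hp.out.two_le
  have hprim : ∀ {s : Plane p}, (p : ZMod (p ^ 2)) • s ≠ 0 → s ≠ 0 := by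
    rintro s hs rfl
    simp at hs
  have hlin : ∀ s, Van B ((p : ZMod (p ^ 2)) • s) → ∀ x, lin B s x = 1 := by
    intro s hs x
    have := hs.p_mul_lin x
    rw [hB] at this
    nlinarith
  have hcos : ∀ s, Van B s → ∀ x ∈ B, lin B s x = B.card ∧ cos B s x = 1 := by
    intro s hs x hx
    have h1 := hs.p_mul_cos x
    have h2 : lin B s x ≤ B.card := card_filter_le _ _
    have h3 := Nat.le_of_dvd (lin_pos (s := s) hx) ⟨_, h1.symm⟩
    have h4 : lin B s x = B.card := by omega
    refine ⟨h4, ?_⟩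
    rw [h4, hB] at h1
    nlinarith
  by_cases hf : ∀ a ∈ B, ∀ b ∈ B, (p : ZMod (p ^ 2)) • (a - b) = 0
  · obtain ⟨a, ha, b, hb, hab⟩ := one_lt_card.1 (show 1 < B.card by omega)
    have hvp : ∀ s : Plane p, (p : ZMod (p ^ 2)) • s ≠ 0 → Van A ((p : ZMod (p ^ 2)) • s) := by
      intro s hs
      refine (h _ hs).resolve_right fun hv => ?_
      have h1 : 2 ≤ fib B b := two_le_card_filter ha hb hab (hf a ha b hb) (by simp)
      have h2 := h1.trans (fib_le_lin (s := s))
      rw [hlin s hv] at h2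
      omega
    obtain ⟨k, hk⟩ := exists_eq_p_smul (hf a ha b hb)
    have hk0 : (p : ZMod (p ^ 2)) • k ≠ 0 := by
      rw [← hk]
      exact sub_ne_zero.2 hab
    obtain ⟨t, ht⟩ := exists_symp_eq_one hk0
    refine exists_orth_of_combos (s := k) (t := t) (X := univ) (Y := pMultiples p) ?_ ?_ ?_
    · rw [ht, mul_one]; exact ZMod.sq_cast_ne_zero
    · rw [hA, card_univ_sq, card_pMultiples]; ring
    · intro x _ x' _ y hy y' hy' hd
      set d := (x - x') • k + (y - y') • t with hd'
      by_cases hpd : (p : ZMod (p ^ 2)) • d = 0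
      · obtain ⟨z, hz⟩ := exists_eq_p_smul hpd
        rw [hz] at hd ⊢
        exact hvp z hd
      · refine (h d hd).resolve_right fun hv => ?_
        have hdk : (p : ZMod (p ^ 2)) * symp d k = 0 := by
          rw [hd', symp_add_left, symp_smul_left, symp_smul_left, symp_self, mul_zero, zero_add,
            ← mul_assoc, pMultiple_sub hy hy', zero_mul]
        have h1 := two_le_cos ha hb hab ((symp_iff_of_p_smul hk0 hpd hdk (hf a ha b hb)).2
          (by rw [hk, symp_smul_left, symp_self, mul_zero]))
        rw [(hcos d hv b hb).2] at h1
        omega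
  · push Not at hf
    obtain ⟨a, ha, b, hb, hab⟩ := hf
    have hne : a ≠ b := by
      rintro rfl
      simp at hab
    set c := a - b with hc
    have hcc : symp c c = 0 := symp_self c
    have hvc : Van A c := (h c (hprim hab)).resolve_right fun hv => by
      have h1 := two_le_cos ha hb hne hcc
      rw [(hcos c hv b hb).2] at h1
      omega
    have hvpc : Van A ((p : ZMod (p ^ 2)) • c) := (h _ hab).resolve_right fun hv => by
      have h1 : 2 ≤ lin B c b := two_le_card_filter ha hb hne (by rw [← hc, hcc, mul_zero])
        (by simp [symp_zero_left])
      rw [hlin c hv] at h1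
      omega
    obtain ⟨t, ht⟩ := exists_symp_eq_one hab
    refine exists_orth_of_combos (s := c) (t := t) (X := univ) (Y := digits p) ?_ ?_ ?_
    · rw [ht, mul_one]; exact ZMod.sq_cast_ne_zero
    · rw [hA, card_univ_sq, card_digits]; ring
    · intro x _ x' _ y hy y' hy' hd
      rcases digit_sub hy hy' with h0 | h0
      · rw [h0, sub_self, zero_smul, add_zero] at hd ⊢
        exact hvc.of_symp_eq_zero hvpc hab hd (by rw [symp_smul_left, hcc, mul_zero])
      · refine (h _ hd).resolve_right fun hv => ?_
        have h1 : (p : ZMod (p ^ 2)) * symp c ((x - x') • c + (y - y') • t) = 0 :=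
          filter_card_eq (hcos _ hv b hb).1 a ha
        rw [symp_add_right, symp_smul_right, symp_smul_right, hcc, ht, mul_zero, zero_add,
          mul_one, h0.mul_left_eq_zero] at h1
        exact ZMod.sq_cast_ne_zero h1

/-- This mirrors the construction of complements at size `p²`: the spectrum is ⟨s⟩, `p • G` or `B`.
Failing these, `exists_direction` applied to `B` supplies `k` with no zeros of `B` parallel to it,
and `w` with `p • w` not a zero of `B`; `A` must vanish there instead. -/
theorem exists_orth_of_card_eq_sq (hA : A.card = p ^ 2) (hB : B.card = p ^ 2)
    (h : ∀ s, s ≠ 0 → Van A s ∨ Van B s) :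
    ∃ S : Finset (Plane p), S.card = A.card ∧ Orth A S := by
  have hp2 := hp.out.two_le
  have hprim : ∀ {s : Plane p}, (p : ZMod (p ^ 2)) • s ≠ 0 → s ≠ 0 := by
    rintro s hs rfl
    simp at hs
  by_cases c1 : ∃ s : Plane p, (p : ZMod (p ^ 2)) • s ≠ 0 ∧ Van A s ∧
      Van A ((p : ZMod (p ^ 2)) • s)
  · obtain ⟨s, hs, hv, hvp⟩ := c1
    obtain ⟨t, ht⟩ := exists_symp_eq_one hs
    refine exists_orth_of_combos (s := s) (t := t) (X := univ) (Y := {0}) ?_ ?_ ?_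
    · rw [ht, mul_one]; exact ZMod.sq_cast_ne_zero
    · rw [hA, card_univ_sq, card_singleton, mul_one]
    · intro x _ x' _ y hy y' hy' hd
      rw [mem_singleton] at hy hy'
      rw [hy, hy', sub_self, zero_smul, add_zero] at hd ⊢
      exact hv.of_symp_eq_zero hvp hs hd (by rw [symp_smul_left, symp_self, mul_zero])
  by_cases c2 : ∀ s : Plane p, (p : ZMod (p ^ 2)) • s ≠ 0 → Van A ((p : ZMod (p ^ 2)) • s)
  · obtain ⟨s, t, ht⟩ := exists_basis p
    refine exists_orth_of_combos (s := s) (t := t) (X := pMultiples p) (Y := pMultiples p)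
      ?_ ?_ ?_
    · rw [ht, mul_one]; exact ZMod.sq_cast_ne_zero
    · rw [hA, card_pMultiples, pow_two]
    · intro x hx x' hx' y hy y' hy' hd
      obtain ⟨z, hz⟩ := exists_eq_p_smul (y := (x - x') • s + (y - y') • t) (by
        rw [smul_add, smul_smul, smul_smul, pMultiple_sub hx hx', pMultiple_sub hy hy']
        simp)
      rw [hz] at hd ⊢
      exact c2 z hd
  by_cases c3 : ∀ a ∈ B, ∀ b ∈ B, (p : ZMod (p ^ 2)) • (a - b) = 0 → a = b
  · refine ⟨B, hB.trans hA.symm, fun a ha b hb hab => ?_⟩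
    refine (h _ (sub_ne_zero.2 hab)).resolve_right fun hv => ?_
    have h0 : (p : ZMod (p ^ 2)) • (a - b) ≠ 0 := fun h0 => hab (c3 a ha b hb h0)
    have h1 := hv.p_mul_cos b
    have h2 : lin B (a - b) b ≤ p * 1 := lin_le_mul h0 fun a _ => fib_le_one c3
    have h3 := two_le_cos ha hb hab (symp_self (a - b))
    nlinarith
  have hfib : ∀ w : Plane p, (p : ZMod (p ^ 2)) • w ≠ 0 → ¬ Van B ((p : ZMod (p ^ 2)) • w) →
      ∀ x, fib B x = p * hco B w x := by
    intro w hw hvw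
    refine fib_eq_p_mul_hco hw fun s' hs' hsw => (h s' (hprim hs')).resolve_left fun hv => ?_
    exact c1 ⟨s', hs', hv, (van_p_smul_iff hw hs' hsw).2 ((h _ hw).resolve_right hvw)⟩
  obtain ⟨w, hw, hvw⟩ : ∃ w : Plane p, (p : ZMod (p ^ 2)) • w ≠ 0 ∧
      ¬ Van B ((p : ZMod (p ^ 2)) • w) := by
    by_contra! hfull
    apply c3
    intro a ha b hb hab
    by_contra hne
    have h1 := card_eq_p_sq_mul_fib hfull b
    have h2 : 2 ≤ fib B b := two_le_card_filter ha hb hne hab (by simp)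
    rw [hB] at h1
    have : 0 < p ^ 2 := by positivity
    nlinarith
  push Not at c2
  obtain ⟨r, hr, hvr⟩ := c2
  obtain ⟨k, hk, hvk, hk'⟩ := exists_direction hB hfib hw hvw ((h _ hr).resolve_left hvr) c3
  refine exists_orth_of_combos (s := w) (t := k) (X := pMultiples p) (Y := digits p) ?_ ?_ ?_
  · intro h0
    exact hvw ((van_p_smul_iff hk hw h0).2 hvk)
  · rw [hA, card_pMultiples, card_digits, pow_two]
  · intro x hx x' hx' y hy y' hy' hd
    rcases digit_sub hy hy' with h0 | h0
    · rw [h0, sub_self, zero_smul, add_zero] at hd ⊢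
      refine ((h _ hw).resolve_right hvw).of_p_smul hw hd ?_
        (by rw [symp_smul_left, symp_self, mul_zero])
      rw [smul_smul, pMultiple_sub hx hx', zero_smul]
    · have h1 : (p : ZMod (p ^ 2)) • ((x - x') • w + (y - y') • k)
          = (p : ZMod (p ^ 2)) • ((y - y') • k) := by
        rw [smul_add, smul_smul _ (x - x'), pMultiple_sub hx hx', zero_smul, zero_add]
      refine (h _ hd).resolve_right (hk' _ ?_ ?_)
      · rw [h1]
        exact p_smul_ne_zero_of_isUnit h0 hk
      · rw [← symp_smul_left, h1, symp_smul_left, symp_smul_left, symp_self, mul_zero, mul_zero]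

theorem IsTile.exists_orth (hA : IsTile A) :
    ∃ S : Finset (Plane p), S.card = A.card ∧ Orth A S := by
  obtain ⟨B, hcard, h⟩ := hA.exists_complement
  have hp0 := hp.out.pos
  obtain ⟨k, hk, hAk⟩ := (Nat.dvd_prime_pow hp.out).1 (Dvd.intro _ hcard)
  have hB : ∀ m, k + m = 4 → B.card = p ^ m := by
    intro m hm
    rw [hAk, ← hm, pow_add] at hcard
    exact Nat.eq_of_mul_eq_mul_left (by positivity) hcard
  interval_cases k
  · exact exists_orth_of_card_one (by rw [hAk, pow_zero])
  · exact exists_orth_of_card_eq_p (by rw [hAk, pow_one]) hcard h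
  · exact exists_orth_of_card_eq_sq hAk (hB 2 rfl) h
  · exact exists_orth_of_card_eq_cube hAk ((hB 1 rfl).trans (pow_one p)) h
  · exact exists_orth_of_card_eq hAk

end TileToSpectral

theorem theorem1 (p : ℕ) [Fact p.Prime] (A : Finset (ZMod (p ^ 2) × ZMod (p ^ 2)))
    (hA : A.Nonempty) : IsSpectral A ↔ IsTile A := by
  rw [isSpectral_iff hA]
  exact ⟨fun ⟨_, hc, h⟩ => h.isTile hc hA, IsTile.exists_orth⟩
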